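/- Let $p$ be an odd prime, $n\ge 1$, and let $G=\mathrm{Hol}(C_{p^n})=C_{p^n}\rtimes\mathrm{Aut}(C_{p^n})$. Let $r$ have multiplicative order $p^{n-1}(p-1)$ modulo $p^n$. Then $G$ has a presentation $$G=\langle a,b\mid a^{p^n}=1,\ b^{p^{n-1}(p-1)}=1,\ b^{-1}ab=a^r\rangle ;$$ fix generators $a,b$ of this kind and a primitive $p^n$-th root of unity $\zeta\in\mathbb C$. Let $\phi$ be Euler's function, $\Phi_m(X)$ the $m$-th cyclotomic polynomial, and $G'$ the commutator subgroup of $G$. The kernel of a representation with character $\chi$ is $\{g : \chi(g)=\chi(1)\}$. The Galois conjugates over $\mathbb Q$ of an irreducible complex representation with character $\chi$ are the representations with characters $\chi^\sigma$, $\sigma\in\mathrm{Gal}(\mathbb Q(\chi)/\mathbb Q)$; its Galois conjugacy class consists of these. For $\omega\in\mathbb C$ with $\omega^{\phi(p^n)}=1$ let $\tilde\rho_{0,\omega}$ be the degree $1$ representation $a\mapsto 1$, $b\mapsto\omega$. For $1\le k\le n$ and $\omega\in\mathbb C$ with $\omega^{p^{n-k}}=1$ let $\tilde\rho_{k,\omega}$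 be the complex representation of degree $m=\phi(p^k)$ that sends $a$ to $\mathrm{diag}(\xi,\xi^{r},\dots,\xi^{r^{m-1}})$, $\xi=\zeta^{p^{n-k}}$, and $b$ to the matrix with entries $1$ directly below the diagonal, $\omega$ in the upper right corner and $0$ elsewhere; for the values of $\omega$ used below, these representations exist and are irreducible. 1. The set of isomorphism classes of irreducible $\mathbb Q$-representations of $G$ whose kernel contains $G'$ is in bijection with the set of Galois conjugacy classes over $\mathbb Q$ of complex representations of $G$ of degree $1$, a representation $\rho$ corresponding to the set of irreducible constituents of $\rho\otimes_{\mathbb Q}\mathbb C$. It is also in bijection with the set of polynomials $\Phi_d(X)$, $d\mid\phi(p^n)$: for every complex root $\omega$ of $\Phi_d$, the complexification of the representation that corresponds to $\Phi_d$ is the direct sum of the distinct Galois conjugates of $\tilde\rho_{0,\omega}$, each taken once, and the character field of $\tilde\rho_{0,\omega}$ is $\mathbb Q(\omega)$. 2. The set of isomorphism classes of irreducible $\mathbb Q$-representations of $G$ whose kernel does not contain $G'$ is in bijection with the set of pairs $(k,\Phi_{p^i}(X))$ with $1\le k\le n$ and $0\le i\le n-k$ (that is, for each $k$, with $\Phi_1,\Phi_p,\dots,\Phi_{p^{n-k}}$):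 for every complex root $\omega$ of $\Phi_{p^i}$, the complexification of the representation that corresponds to $(k,\Phi_{p^i})$ is the direct sum of the distinct Galois conjugates of $\tilde\rho_{k,\omega}$, each taken once, and the character field of $\tilde\rho_{k,\omega}$ is $\mathbb Q(\omega)$. 3. The number of isomorphism classes of irreducible $\mathbb Q$-representations of $G$ is $d(\phi(p^n))+\frac{n(n+1)}2$, where $d(m)$ is the number of divisors of $m$. -/

import Mathlib

open scoped TensorProduct

noncomputable section

/-- The holomorph of a group: the semidirect product `C ⋊ Aut C` for the natural action. -/
abbrev Holomorph (C : Type*) [Group C] : Type _ :=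
  C ⋊[MonoidHom.id (MulAut C)] MulAut C

/-- The relators `a ^ N`, `b ^ M` and `b⁻¹ * a * b * (a ^ r)⁻¹` on the free generators
`a = of 0` and `b = of 1`. -/
def metacyclicRels (N M r : ℕ) : Set (FreeGroup (Fin 2)) :=
  {FreeGroup.of 0 ^ N, FreeGroup.of 1 ^ M,
    (FreeGroup.of 1)⁻¹ * FreeGroup.of 0 * FreeGroup.of 1 * (FreeGroup.of 0 ^ r)⁻¹}

/-- `G` has the presentation `⟨a, b | a ^ N = 1, b ^ M = 1, b⁻¹ a b = a ^ r⟩`, with the given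
elements `a`, `b` of `G` as the generators. -/
def HasMetacyclicPresentation {G : Type*} [Group G] (N M r : ℕ) (a b : G) : Prop :=
  ∃ e : PresentedGroup (metacyclicRels N M r) ≃* G,
    e (PresentedGroup.of 0) = a ∧ e (PresentedGroup.of 1) = b

universe u v

/-- A finite-dimensional irreducible representation of `G` over `k`. -/
structure Irrep (k : Type u) [Field k] (G : Type v) [Group G] where
  /-- the representation space -/
  V : Type u
  [addCommGroup : AddCommGroup V]
  [module : Module k V]
  [finiteDimensional : FiniteDimensional k V]
  /-- the action -/
  ρ : Representation k G V
  irreducible : ρ.IsIrreducible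

attribute [instance] Irrep.addCommGroup Irrep.module Irrep.finiteDimensional

/-- Equivalence (isomorphism) of irreducible representations. -/
instance Irrep.setoid (k : Type u) [Field k] (G : Type v) [Group G] : Setoid (Irrep k G) where
  r X Y := Nonempty (X.ρ.Equiv Y.ρ)
  iseqv :=
    { refl := fun X => ⟨Representation.Equiv.refl X.ρ⟩
      symm := fun ⟨e⟩ => ⟨e.symm⟩
      trans := fun ⟨e⟩ ⟨f⟩ => ⟨e.trans f⟩ }

/-- The set of inequivalent irreducible representations of `G` over `k`, that is, the set of
their isomorphism classes. -/
abbrev IrrepClass (k : Type u) [Field k] (G : Type v) [Group G] : Type (max (u + 1) v) :=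
  Quotient (Irrep.setoid k G)

/-- The complexification `ℂ ⊗ V` of a rational representation `V`. -/
def complexification {G : Type v} [Group G] {V : Type u} [AddCommGroup V] [Module ℚ V]
    (ρ : Representation ℚ G V) : Representation ℂ G (ℂ ⊗[ℚ] V) :=
  (Module.End.baseChangeHom ℚ ℂ V : Module.End ℚ V →* Module.End ℂ (ℂ ⊗[ℚ] V)).comp ρ

/-- The representation on column vectors given by a homomorphism to matrices. -/
def matrixRep {G : Type v} [Group G] {m : ℕ} (τ : G →* Matrix (Fin m) (Fin m) ℂ) :
    Representation ℂ G (Fin m → ℂ) :=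
  (Matrix.toLinAlgEquiv' :
    Matrix (Fin m) (Fin m) ℂ ≃ₐ[ℂ] Module.End ℂ (Fin m → ℂ)).toMonoidHom.comp τ

namespace IrrepClass

variable {k : Type u} [Field k] {G : Type v} [Group G]

/-- The character of an isomorphism class. -/
def character (x : IrrepClass k G) : G → k :=
  Quotient.lift (fun X : Irrep k G => X.ρ.character)
    (fun _ _ h => Nonempty.elim h fun e => Representation.char_iso e) x

/-- The degree (dimension) of an isomorphism class. -/
def degree (x : IrrepClass k G) : ℕ :=
  Quotient.lift (fun X : Irrep k G => Module.finrank k X.V)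
    (fun _ _ h => Nonempty.elim h fun e => e.toLinearEquiv.finrank_eq) x

/-- The kernel `{g | χ g = χ 1}` of a representation with character `χ`. -/
def kernel (x : IrrepClass k G) : Set G := {g | x.character g = x.character 1}

/-- The character field `ℚ(χ)` of a complex irreducible representation. -/
def charField (x : IrrepClass ℂ G) : IntermediateField ℚ ℂ :=
  IntermediateField.adjoin ℚ (Set.range x.character)

theorem character_mem_charField (x : IrrepClass ℂ G) (g : G) : x.character g ∈ x.charField :=
  IntermediateField.subset_adjoin ℚ _ ⟨g, rfl⟩

/-- The Galois conjugacy class over `ℚ` of a complex irreducible representation with character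
`χ`: the irreducible representations with character `χ^σ`, where `σ ∈ Gal(ℚ(χ)/ℚ)`. -/
def galoisClass (x : IrrepClass ℂ G) : Set (IrrepClass ℂ G) :=
  {y | ∃ σ : x.charField ≃ₐ[ℚ] x.charField,
    ∀ g, y.character g = (σ ⟨x.character g, x.character_mem_charField g⟩ : ℂ)}

/-- The irreducible constituents of the complexification of a rational irreducible
representation. -/
def complexConstituents (c : IrrepClass ℚ G) : Set (IrrepClass ℂ G) :=
  {x | ∃ f : Representation.IntertwiningMap x.out.ρ (complexification c.out.ρ), f ≠ 0}

/-- The complexification of `c` is the direct sum of the Galois conjugates of `x`, each of them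
taken once. -/
def IsGaloisOrbitSum (c : IrrepClass ℚ G) (x : IrrepClass ℂ G) : Prop :=
  Nonempty ((complexification c.out.ρ).Equiv
    (Representation.directSum fun y : x.galoisClass => y.1.out.ρ))

/-- The representation `x` is afforded, in a suitable basis, by a matrix representation that
sends `a` to `A` and `b` to `B`. -/
def AffordedBy {m : ℕ} (x : IrrepClass ℂ G) (a b : G) (A B : Matrix (Fin m) (Fin m) ℂ) : Prop :=
  ∃ τ : G →* Matrix (Fin m) (Fin m) ℂ, τ a = A ∧ τ b = B ∧
    Nonempty (x.out.ρ.Equiv (matrixRep τ))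

end IrrepClass

/-- The diagonal matrix `diag(z, z ^ r, z ^ (r ^ 2), …, z ^ (r ^ (m - 1)))`. -/
def diagMatrix (m r : ℕ) (z : ℂ) : Matrix (Fin m) (Fin m) ℂ :=
  Matrix.diagonal fun j => z ^ (r ^ (j : ℕ))

/-- The monomial matrix with `1`'s below the diagonal and `ω` in the upper right corner
(the `1 × 1` matrix `ω` if `m = 1`). -/
def monomialMatrix (m : ℕ) (ω : ℂ) : Matrix (Fin m) (Fin m) ℂ :=
  Matrix.of fun i j =>
    if (i : ℕ) = j + 1 then 1 else if (i : ℕ) = 0 ∧ (j : ℕ) + 1 = m then ω else 0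

end

/-! Write `ξ = ζ ^ p ^ (n - k)`. Powers of `b` carry an eigenvector of `a` to eigenvectors whose
eigenvalues are its powers with exponents `r ^ j`, and `r` generates the units modulo `p ^ k`. So a
nonzero complex representation contains, for some `k`, an eigenvector of `a` with eigenvalue exactly
`ξ`. Since `b ^ φ(p ^ k)` preserves that eigenspace, there is a joint eigenvector, with a second
eigenvalue `ω` (`exists_joint_eigenvector`). It generates an image of the monomial representation
with parameters `(k, ω)`, hence these are all the complex irreducibles; they are subject only to `ω
^ (φ(p ^ n) / φ(p ^ k)) = 1`, and `k = 0` gives degree `1`. Character values are rational multiples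
of powers of `ω`, so the character field is `ℚ(ω)` and the Galois conjugates replace `ω` by the
other roots of unity of the same order `d`.

Over `ℚ` the pair `(k, d)` is recorded by two relations: `Φ_{p ^ k}` kills `a`, and `Φ_d` kills `b ^
φ(p ^ k)`. The complexification of a nonzero rational representation with these relations contains
every conjugate, so its dimension is at least `φ(d) φ(p ^ k)`; equality forces irreducibility and
makes the complexification the sum of the conjugates, each once
(`isIrreducible_and_directSum_of_finrank`).

The heart is to attain this dimension, that is, to see that all Schur indices are `1`
(`exists_isRationalClass`). If `p ^ k ∣ d`, the monomial representation over `ℚ(ζ_d)`, viewed over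
`ℚ`, will do. Otherwise `d = p ^ i` with `i < k`; then `φ(p ^ i)` blocks `ℚ(ζ_{p ^ k})` suffice,
with a semilinear corner `z τ` in the shift. A power of `z τ` is multiplication by a root of unity,
and lifting the exponent shows that its order is `p ^ i`.

Finally, rational irreducibles that share a complex constituent are isomorphic, because a nonzero
complex intertwiner has a nonzero rational coordinate. So the rational irreducibles correspond to
the pairs `(k, d)` with `d ∣ φ(p ^ n) / φ(p ^ k)`. As `a` is in `G'`, the kernel contains `G'`
exactly when `k = 0`. -/

noncomputable section

/-! ### Metacyclic presentations: universal property and normal form -/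

namespace HasMetacyclicPresentation

variable {G : Type*} [Group G] {N M r : ℕ} {a b : G}

theorem relations (h : HasMetacyclicPresentation N M r a b) :
    a ^ N = 1 ∧ b ^ M = 1 ∧ a * b = b * a ^ r := by
  obtain ⟨e, rfl, rfl⟩ := h
  have key : ∀ x ∈ metacyclicRels N M r, e (PresentedGroup.mk _ x) = 1 := fun x hx => by
    rw [PresentedGroup.one_of_mem hx, map_one]
  refine ⟨?_, ?_, ?_⟩
  · simpa [PresentedGroup.of] using key (FreeGroup.of 0 ^ N) (by simp [metacyclicRels])
  · simpa [PresentedGroup.of] using key (FreeGroup.of 1 ^ M) (by simp [metacyclicRels])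
  · have := key ((FreeGroup.of 1)⁻¹ * FreeGroup.of 0 * FreeGroup.of 1 * (FreeGroup.of 0 ^ r)⁻¹)
      (by simp [metacyclicRels])
    simp only [map_mul, map_inv, map_pow] at this
    have h2 := mul_inv_eq_one.mp this
    rw [mul_assoc, inv_mul_eq_iff_eq_mul] at h2
    exact h2

theorem exists_hom (h : HasMetacyclicPresentation N M r a b) {H : Type*} [Group H] {A B : H}
    (hA : A ^ N = 1) (hB : B ^ M = 1) (hAB : A * B = B * A ^ r) :
    ∃ f : G →* H, f a = A ∧ f b = B := by
  obtain ⟨e, rfl, rfl⟩ := h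
  have hrel : ∀ x ∈ metacyclicRels N M r, FreeGroup.lift ![A, B] x = 1 := by
    rintro x (rfl | rfl | rfl)
    · simpa using hA
    · simpa using hB
    · simp only [map_mul, map_inv, map_pow, FreeGroup.lift_apply_of]
      simp [mul_assoc B⁻¹, hAB]
  refine ⟨(PresentedGroup.toGroup hrel).comp e.symm.toMonoidHom, ?_, ?_⟩ <;>
    simp [PresentedGroup.toGroup.of]

theorem closure_eq_top (h : HasMetacyclicPresentation N M r a b) :
    Subgroup.closure {a, b} = ⊤ := by
  obtain ⟨e, rfl, rfl⟩ := h
  have h1 := PresentedGroup.closure_range_of (metacyclicRels N M r)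
  have h2 := congrArg (Subgroup.map e.toMonoidHom) h1
  rw [MonoidHom.map_closure, ← MonoidHom.range_eq_map,
    MonoidHom.range_eq_top.mpr e.surjective] at h2
  rw [← h2]
  congr 1
  ext x
  simp [Set.mem_image, Fin.exists_fin_two, eq_comm]

end HasMetacyclicPresentation

theorem mul_pow_eq_of_rel {S : Type*} [Monoid S] {a b : S} {r : ℕ} (h : a * b = b * a ^ r)
    (j : ℕ) : a * b ^ j = b ^ j * a ^ (r ^ j) := by
  have h' : ∀ i, a ^ i * b = b * a ^ (r * i) := fun i => by
    induction i with
    | zero => simp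
    | succ i ih => rw [pow_succ', mul_assoc, ih, ← mul_assoc, h, mul_assoc, ← pow_add]; ring_nf
  induction j with
  | zero => simp
  | succ j ih => rw [pow_succ, ← mul_assoc, ih, mul_assoc, h', ← mul_assoc, pow_succ' r]

theorem pow_mul_pow_eq_of_rel {S : Type*} [Monoid S] {a b : S} {r : ℕ} (h : a * b = b * a ^ r)
    (i j : ℕ) : a ^ i * b ^ j = b ^ j * a ^ (r ^ j * i) := by
  induction i with
  | zero => simp
  | succ i ih =>
    rw [pow_succ', mul_assoc, ih, ← mul_assoc, mul_pow_eq_of_rel h, mul_assoc, ← pow_add]; ring_nf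

/-- Both generators have finite order, so positive words suffice, and the relation moves each new
`b` to the left past the power of `a`. This bounds the order of the presented group by `M * N`. -/
theorem exists_eq_pow_mul_pow {G : Type*} [Group G] {a b : G} {N M r : ℕ} (hN : 0 < N)
    (hM : 0 < M) (ha : a ^ N = 1) (hb : b ^ M = 1) (h : a * b = b * a ^ r)
    (hcl : Subgroup.closure {a, b} = ⊤) (g : G) : ∃ j < M, ∃ i < N, g = b ^ j * a ^ i := by
  have hmod : ∀ j i : ℕ, ∃ j' < M, ∃ i' < N, b ^ j * a ^ i = b ^ j' * a ^ i' := fun j i =>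
    ⟨j % M, Nat.mod_lt _ hM, i % N, Nat.mod_lt _ hN, by
      rw [← pow_eq_pow_mod _ ha, ← pow_eq_pow_mod _ hb]⟩
  have hfin : ∀ x ∈ ({a, b} : Set G), IsOfFinOrder x := by
    rintro x (rfl | rfl)
    · exact isOfFinOrder_iff_pow_eq_one.mpr ⟨N, hN, ha⟩
    · exact isOfFinOrder_iff_pow_eq_one.mpr ⟨M, hM, hb⟩
  have hg : g ∈ Submonoid.closure ({a, b} : Set G) := by
    rw [← Subgroup.closure_toSubmonoid_of_isOfFinOrder hfin, hcl]
    trivial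
  suffices ∃ j i : ℕ, g = b ^ j * a ^ i by
    obtain ⟨j, i, rfl⟩ := this; exact hmod j i
  induction hg using Submonoid.closure_induction_right with
  | one => exact ⟨0, 0, by simp⟩
  | mul_right x _ y hy ih =>
    obtain ⟨j, i, rfl⟩ := ih
    rcases hy with rfl | rfl
    · exact ⟨j, i + 1, by rw [pow_succ, mul_assoc]⟩
    · refine ⟨j + 1, r * i, ?_⟩
      have := pow_mul_pow_eq_of_rel h i 1
      rw [pow_one, pow_one] at this
      rw [mul_assoc, this, pow_succ, mul_assoc]

/-- The standing data: generators `a`, `b` of a group with the metacyclic presentation of the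
holomorph of a cyclic group of order `p ^ n`, and a primitive `p ^ n`-th root of unity. -/
structure HolomorphGenerators (p n r : ℕ) {G : Type*} [Group G] (a b : G) (ζ : ℂ) : Prop where
  prime : p.Prime
  odd : p ≠ 2
  pos : 1 ≤ n
  order : orderOf (r : ZMod (p ^ n)) = Nat.totient (p ^ n)
  pres : HasMetacyclicPresentation (p ^ n) (Nat.totient (p ^ n)) r a b
  root : IsPrimitiveRoot ζ (p ^ n)

/-! ### Primitive roots modulo `N` and the presentation of the holomorph -/

theorem coprime_of_orderOf_pos {N r : ℕ} (h : 0 < orderOf (r : ZMod N)) : r.Coprime N := by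
  have : IsUnit (r : ZMod N) := (orderOf_pos_iff.mp h).isUnit
  exact (ZMod.isUnit_iff_coprime r N).mp this

/-- A natural number whose order modulo `N` is `φ N` generates the units modulo each divisor
of `N`. -/
theorem exists_pow_modEq_of_orderOf_eq_totient {N r : ℕ} (hN : 0 < N)
    (h : orderOf (r : ZMod N) = Nat.totient N) {D t : ℕ} (hD : D ∣ N) (ht : t.Coprime D) :
    ∃ j, t ≡ r ^ j [MOD D] := by
  have : NeZero N := ⟨hN.ne'⟩
  have hr : r.Coprime N := coprime_of_orderOf_pos (by rw [h]; exact Nat.totient_pos.mpr hN)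
  obtain ⟨u, hu⟩ := ZMod.unitsMap_surjective hD (ZMod.unitOfCoprime t ht)
  have hgen : ∀ x : (ZMod N)ˣ, x ∈ Subgroup.zpowers (ZMod.unitOfCoprime r hr) := by
    have hc : Nat.card (Subgroup.zpowers (ZMod.unitOfCoprime r hr)) = Nat.card (ZMod N)ˣ := by
      rw [Nat.card_zpowers, ← orderOf_units, ZMod.coe_unitOfCoprime, h, Nat.card_eq_fintype_card,
        ZMod.card_units_eq_totient]
    intro x
    rw [Subgroup.eq_top_of_card_eq _ hc]
    trivial
  obtain ⟨j, hj⟩ := (mem_powers_iff_mem_zpowers (x := ZMod.unitOfCoprime r hr)).mpr (hgen u)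
  refine ⟨j, ?_⟩
  rw [← ZMod.natCast_eq_natCast_iff]
  have := congrArg (fun x : (ZMod D)ˣ => (x : ZMod D)) hu
  simp only [ZMod.coe_unitOfCoprime] at this
  rw [← this, ← hj]
  simp [ZMod.unitsMap_def]

/-- Reduction of units from `N` to a divisor `D` is surjective, so it carries a generator to a
generator. -/
theorem orderOf_natCast_eq_totient_of_dvd {N r : ℕ} (hN : 0 < N)
    (h : orderOf (r : ZMod N) = Nat.totient N) {D : ℕ} (hD : D ∣ N) :
    orderOf (r : ZMod D) = Nat.totient D := by
  have : NeZero D := ⟨(Nat.pos_of_dvd_of_pos hD hN).ne'⟩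
  have hr : r.Coprime D := (coprime_of_orderOf_pos
    (by rw [h]; exact Nat.totient_pos.mpr hN)).coprime_dvd_right hD
  have htop : Subgroup.zpowers (ZMod.unitOfCoprime r hr) = ⊤ := by
    rw [eq_top_iff]
    intro x _
    obtain ⟨j, hj⟩ := exists_pow_modEq_of_orderOf_eq_totient hN h hD (ZMod.val_coe_unit_coprime x)
    refine ⟨j, Units.ext ?_⟩
    rw [← ZMod.natCast_eq_natCast_iff] at hj
    simpa using hj.symm
  rw [← ZMod.coe_unitOfCoprime r hr, orderOf_units, orderOf_eq_card_of_zpowers_eq_top htop,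
    Nat.card_eq_fintype_card, ZMod.card_units_eq_totient]

/-- A generator `c` of `C` and the inverse of the automorphism `x ↦ x ^ r` satisfy the relations and
generate the holomorph. The normal form shows that the presented group is no larger than the
holomorph, so the resulting surjection is an isomorphism. -/
theorem exists_hasMetacyclicPresentation_holomorph {N r : ℕ} (hN : 0 < N)
    (h : orderOf (r : ZMod N) = Nat.totient N) (C : Type*) [Group C] [IsCyclic C]
    (hC : Nat.card C = N) :
    ∃ a b : Holomorph C, HasMetacyclicPresentation N (Nat.totient N) r a b := by
  have hfinC : Finite C := Nat.finite_of_card_ne_zero (by omega)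
  have hM : 0 < Nat.totient N := Nat.totient_pos.mpr hN
  have hr : r.Coprime N := coprime_of_orderOf_pos (by omega)
  obtain ⟨c, hc⟩ := IsCyclic.exists_generator (α := C)
  have hpow : ∀ x : C, ∃ i : ℕ, c ^ i = x := fun x =>
    (mem_powers_iff_mem_zpowers (x := c)).mpr (hc x)
  have hcord : orderOf c = N := by rw [orderOf_eq_card_of_forall_mem_zpowers hc, hC]
  let f : C →* C :=
    { toFun := fun x => x ^ r
      map_one' := one_pow r
      map_mul' := fun x y =>
        (show Commute x y from (IsCyclic.isMulCommutative (α := C)).is_comm.comm x y).mul_pow r }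
  have hf : Function.Injective f := by
    rw [injective_iff_map_eq_one]
    intro x hx
    have h1 : orderOf x ∣ r := orderOf_dvd_of_pow_eq_one hx
    have h2 : orderOf x ∣ N := hC ▸ orderOf_dvd_natCard x
    exact orderOf_eq_one_iff.mp (Nat.eq_one_of_dvd_coprimes hr h1 h2)
  let ψ : MulAut C := MulEquiv.ofBijective f (Finite.injective_iff_bijective.mp hf)
  have hψ : ∀ (j : ℕ) x, (ψ ^ j) x = x ^ r ^ j := fun j => by
    induction j with
    | zero => simp
    | succ j ih => intro x; rw [pow_succ', MulAut.mul_apply, ih, pow_succ, pow_mul]; rfl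
  -- An automorphism sends `c` to `c ^ t` with `t` prime to `N`, and such a `t` is a power of `r`
  -- modulo `N`.
  have hgen : ∀ σ : MulAut C, ∃ j : ℕ, ψ ^ j = σ := by
    intro σ
    obtain ⟨t, ht⟩ := hpow (σ c)
    have hto : orderOf (c ^ t) = N := by rw [ht, MulEquiv.orderOf_eq, hcord]
    have htc : t.Coprime N := by
      rw [orderOf_pow, hcord] at hto
      rw [Nat.coprime_comm]
      have h1 := Nat.gcd_dvd_left N t
      exact (Nat.div_eq_self.mp hto).resolve_left hN.ne'
    obtain ⟨j, hj⟩ := exists_pow_modEq_of_orderOf_eq_totient hN h dvd_rfl htc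
    refine ⟨j, MulEquiv.ext fun x => ?_⟩
    obtain ⟨i, rfl⟩ := hpow x
    rw [map_pow, map_pow, hψ, ← ht]
    congr 1
    rw [pow_eq_pow_iff_modEq, hcord]
    exact hj.symm
  let A : Holomorph C := SemidirectProduct.inl c
  -- The inverse is needed because the relation conjugates as `b⁻¹ a b`, whereas `inr ψ` acts on the
  -- normal factor by `g ↦ inr ψ * g * (inr ψ)⁻¹`.
  let B : Holomorph C := SemidirectProduct.inr ψ⁻¹
  have hA : A ^ N = 1 := by
    rw [← map_pow, ← hC, pow_card_eq_one', map_one]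
  have hB : B ^ Nat.totient N = 1 := by
    rw [← map_pow, ← hC, ← IsCyclic.card_mulAut, pow_card_eq_one', map_one]
  have hAB : A * B = B * A ^ r := by
    have h1 : ψ⁻¹ (c ^ r) = c := by
      rw [MulAut.inv_apply, MulEquiv.symm_apply_eq]; rfl
    ext <;> simp [A, B, ← map_pow, h1]
  have hrel : ∀ x ∈ metacyclicRels N (Nat.totient N) r, FreeGroup.lift ![A, B] x = 1 := by
    rintro x (rfl | rfl | rfl)
    · simpa using hA
    · simpa using hB
    · simp only [map_mul, map_inv, map_pow, FreeGroup.lift_apply_of]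
      simp [mul_assoc B⁻¹, hAB]
  let P := PresentedGroup (metacyclicRels N (Nat.totient N) r)
  let F : P →* Holomorph C := PresentedGroup.toGroup hrel
  have hF0 : F (PresentedGroup.of 0) = A := PresentedGroup.toGroup.of hrel
  have hF1 : F (PresentedGroup.of 1) = B := PresentedGroup.toGroup.of hrel
  have hsurj : Function.Surjective F := by
    intro g
    obtain ⟨i, hi⟩ := hpow g.left
    obtain ⟨j, hj⟩ := hgen g.right
    refine ⟨PresentedGroup.of 0 ^ i * (PresentedGroup.of 1)⁻¹ ^ j, ?_⟩
    rw [map_mul, map_pow, map_pow, map_inv, hF0, hF1, ← map_pow, hi, ← map_inv, inv_inv, ← map_pow,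
      hj, SemidirectProduct.inl_left_mul_inr_right]
  have hP : HasMetacyclicPresentation N (Nat.totient N) r
      (PresentedGroup.of 0 : P) (PresentedGroup.of 1) := ⟨MulEquiv.refl _, rfl, rfl⟩
  obtain ⟨ha, hb, hab⟩ := hP.relations
  let E : Fin (Nat.totient N) × Fin N → P := fun q =>
    (PresentedGroup.of 1) ^ (q.1 : ℕ) * (PresentedGroup.of 0) ^ (q.2 : ℕ)
  have hE : Function.Surjective E := fun g => by
    obtain ⟨j, hj, i, hi, rfl⟩ := exists_eq_pow_mul_pow hN hM ha hb hab hP.closure_eq_top g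
    exact ⟨(⟨j, hj⟩, ⟨i, hi⟩), rfl⟩
  have hPfin : Finite P := Finite.of_surjective E hE
  have hcard : Nat.card P ≤ Nat.card (Holomorph C) := by
    refine (Nat.card_le_card_of_surjective E hE).trans ?_
    rw [SemidirectProduct.card, IsCyclic.card_mulAut, hC]
    simp [mul_comm]
  have hfinH : Finite (Holomorph C) := Finite.of_surjective F hsurj
  exact ⟨A, B, MulEquiv.ofBijective F (hsurj.bijective_of_nat_card_le hcard), hF0, hF1⟩

/-! ### Block monomial endomorphisms and the representations they define -/

section Monomial

variable {R K : Type*} [CommRing R] [AddCommGroup K] [Module R K]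

/-- The block diagonal endomorphism `diag(α, α ^ r, α ^ (r ^ 2), …)` of `K ^ f`. -/
def diagonalEnd (f r : ℕ) (α : Module.End R K) : Module.End R (Fin f → K) :=
  LinearMap.pi fun j => (α ^ r ^ (j : ℕ)) ∘ₗ LinearMap.proj j

/-- The cyclic block shift of `K ^ f`, with `T` in the upper right corner. -/
def cyclicShiftEnd (f : ℕ) (T : Module.End R K) : Module.End R (Fin f → K) :=
  LinearMap.pi fun j : Fin f =>
    if (j : ℕ) = 0 then T ∘ₗ LinearMap.proj ⟨f - 1, by have := j.2; omega⟩
    else LinearMap.proj ⟨j - 1, by have := j.2; omega⟩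

@[simp] theorem diagonalEnd_apply (f r : ℕ) (α : Module.End R K) (v : Fin f → K) (j : Fin f) :
    diagonalEnd f r α v j = (α ^ r ^ (j : ℕ)) (v j) := rfl

theorem cyclicShiftEnd_apply (f : ℕ) (T : Module.End R K) (v : Fin f → K) (j : Fin f) :
    cyclicShiftEnd f T v j = if (j : ℕ) = 0 then T (v ⟨f - 1, by have := j.2; omega⟩)
      else v ⟨j - 1, by have := j.2; omega⟩ := by
  simp only [cyclicShiftEnd, LinearMap.pi_apply]
  split_ifs <;> rfl

theorem diagonalEnd_pow (f r : ℕ) (α : Module.End R K) (s : ℕ) :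
    diagonalEnd f r α ^ s = diagonalEnd f r (α ^ s) := by
  induction s with
  | zero => ext; simp
  | succ s ih =>
    refine LinearMap.ext fun v => funext fun j => ?_
    rw [pow_succ, ih, Module.End.mul_apply, diagonalEnd_apply, diagonalEnd_apply,
      diagonalEnd_apply, ← Module.End.mul_apply, ← pow_mul, ← pow_mul, ← pow_add, Nat.succ_mul]

theorem compLeft_pow (f : ℕ) (T : Module.End R K) (s : ℕ) :
    (T.compLeft (Fin f) : Module.End R (Fin f → K)) ^ s = (T ^ s).compLeft (Fin f) := by
  induction s with
  | zero => ext; simp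
  | succ s ih => rw [pow_succ, ih]; rfl

theorem cyclicShiftEnd_single {f : ℕ} (T : Module.End R K) {j : ℕ} (hj : j + 1 < f) (x : K) :
    cyclicShiftEnd f T (Pi.single ⟨j, by omega⟩ x) = Pi.single ⟨j + 1, hj⟩ x := by
  ext i
  rw [cyclicShiftEnd_apply]
  simp only [Pi.single_apply, Fin.ext_iff]
  split_ifs <;> first | omega | simp_all

theorem cyclicShiftEnd_single_last {f : ℕ} (T : Module.End R K) (hf : 0 < f) (x : K) :
    cyclicShiftEnd f T (Pi.single ⟨f - 1, by omega⟩ x) = Pi.single ⟨0, hf⟩ (T x) := by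
  ext i
  rw [cyclicShiftEnd_apply]
  simp only [Pi.single_apply, Fin.ext_iff]
  have := i.2
  split_ifs <;> first | omega | simp_all

theorem cyclicShiftEnd_pow_single {f : ℕ} (T : Module.End R K) {j : ℕ} (t : ℕ) (hj : j + t < f)
    (x : K) : (cyclicShiftEnd f T ^ t) (Pi.single ⟨j, by omega⟩ x) = Pi.single ⟨j + t, hj⟩ x := by
  induction t with
  | zero => rfl
  | succ t ih =>
    rw [pow_succ', Module.End.mul_apply, ih (by omega), cyclicShiftEnd_single T (by omega)]
    rfl

theorem cyclicShiftEnd_pow_single_zero {f : ℕ} (T : Module.End R K) (hf : 0 < f) (x : K) :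
    (cyclicShiftEnd f T ^ f) (Pi.single ⟨0, hf⟩ x) = Pi.single ⟨0, hf⟩ (T x) := by
  have := cyclicShiftEnd_pow_single (f := f) T (j := 0) (f - 1) (by omega) x
  rw [show cyclicShiftEnd f T ^ f = cyclicShiftEnd f T * cyclicShiftEnd f T ^ (f - 1) by
    rw [← pow_succ', Nat.sub_add_cancel hf], Module.End.mul_apply, this]
  simp only [zero_add]
  exact cyclicShiftEnd_single_last T hf x

/-- In `f` shifts each block goes once around the cycle and passes the corner, where `T` sits,
exactly once. -/
theorem cyclicShiftEnd_pow_self {f : ℕ} (T : Module.End R K) :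
    cyclicShiftEnd f T ^ f = T.compLeft (Fin f) := by
  refine LinearMap.pi_ext fun j x => ?_
  have hf : 0 < f := j.pos
  have h := cyclicShiftEnd_pow_single (f := f) T (j := 0) (j : ℕ) (by have := j.2; omega) x
  have h' := cyclicShiftEnd_pow_single (f := f) T (j := 0) (j : ℕ) (by have := j.2; omega) (T x)
  simp only [zero_add, Fin.eta] at h h'
  rw [← h, ← Module.End.mul_apply, ← pow_add, add_comm f, pow_add, Module.End.mul_apply,
    cyclicShiftEnd_pow_single_zero T hf, h', h]
  ext i
  by_cases hi : i = j
  · subst hi; simp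
  · simp [Pi.single_eq_of_ne hi]

/-- Away from the corner the relation is built into the exponents `r ^ j`; only the corner imposes a
condition. Leaving `T` free to commute with `α` up to a power is what later admits semilinear
corners. -/
theorem diagonalEnd_mul_cyclicShiftEnd {f r : ℕ} {α T : Module.End R K}
    (h : α * T = T * α ^ r ^ f) :
    diagonalEnd f r α * cyclicShiftEnd f T = cyclicShiftEnd f T * diagonalEnd f r α ^ r := by
  rw [diagonalEnd_pow]
  refine LinearMap.ext fun v => funext fun ⟨j, hjf⟩ => ?_
  simp only [Module.End.mul_apply, diagonalEnd_apply, cyclicShiftEnd_apply]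
  split_ifs with hj
  · subst hj
    rw [pow_zero, pow_one, ← Module.End.mul_apply, h, Module.End.mul_apply, ← pow_mul,
      ← pow_succ', Nat.sub_add_cancel hjf]
  · rw [← pow_mul, ← pow_succ', Nat.sub_add_cancel (by omega)]

end Monomial

/-- The representation of a metacyclic group on `K ^ f` in which `a` acts block diagonally and `b`
acts as a cyclic block shift. -/
theorem HasMetacyclicPresentation.exists_monomial_representation {G : Type*} [Group G]
    {N M r : ℕ} {a b : G} (h : HasMetacyclicPresentation N M r a b) {R K : Type*} [CommRing R]
    [AddCommGroup K] [Module R K] {f s : ℕ} (hN : 0 < N) (hM : 0 < M) (hfs : f * s = M)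
    {α T : Module.End R K} (hα : α ^ N = 1) (hT : T ^ s = 1) (hαT : α * T = T * α ^ r ^ f) :
    ∃ ρ : Representation R G (Fin f → K), ρ a = diagonalEnd f r α ∧ ρ b = cyclicShiftEnd f T := by
  have hA : diagonalEnd f r α ^ N = 1 := by
    rw [diagonalEnd_pow, hα]; ext; simp
  have hB : cyclicShiftEnd f T ^ M = 1 := by
    rw [← hfs, pow_mul, cyclicShiftEnd_pow_self, compLeft_pow, hT]; rfl
  -- The universal property concerns maps into groups, so the endomorphisms are first made units by
  -- means of their finite order.
  obtain ⟨F, hFa, hFb⟩ := h.exists_hom (A := Units.ofPowEqOne _ N hA hN.ne')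
    (B := Units.ofPowEqOne _ M hB hM.ne') (Units.pow_ofPowEqOne _ _) (Units.pow_ofPowEqOne _ _)
    (Units.ext (by simpa using diagonalEnd_mul_cyclicShiftEnd hαT))
  exact ⟨(Units.coeHom _).comp F, by simp [hFa], by simp [hFb]⟩

/-- A linear map that commutes with the action of generators is an intertwining map. -/
theorem exists_intertwiningMap_of_closure {G R V W : Type*} [Group G] [CommRing R]
    [AddCommGroup V] [Module R V] [AddCommGroup W] [Module R W] {ρ : Representation R G V}
    {σ : Representation R G W} {s : Set G} (hs : Subgroup.closure s = ⊤) (F : V →ₗ[R] W)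
    (hF : ∀ g ∈ s, ∀ v, F (ρ g v) = σ g (F v)) :
    ∃ Φ : Representation.IntertwiningMap ρ σ, ∀ v, Φ v = F v := by
  have key : ∀ g v, F (ρ g v) = σ g (F v) := by
    intro g
    have hg : g ∈ Subgroup.closure s := hs ▸ Subgroup.mem_top g
    induction hg using Subgroup.closure_induction with
    | mem x hx => exact hF x hx
    | one => simp
    | mul x y _ _ hx hy => intro v; simp [hx, hy]
    | inv x _ hx =>
      intro v
      have := hx (ρ x⁻¹ v)
      rw [Representation.self_inv_apply] at this
      rw [this, Representation.inv_self_apply]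
  exact ⟨F.intertwiningMap_of_isIntertwiningMap ρ σ key, fun v => rfl⟩

/-- A subspace stable under elements of finite order that generate the group is a
subrepresentation. -/
theorem exists_subrepresentation_of_closure {G R V : Type*} [Group G] [CommRing R]
    [AddCommGroup V] [Module R V] {ρ : Representation R G V} {s : Set G}
    (hs : Subgroup.closure s = ⊤) (hfin : ∀ g ∈ s, IsOfFinOrder g) (E : Submodule R V)
    (hE : ∀ g ∈ s, ∀ v ∈ E, ρ g v ∈ E) :
    ∃ S : Subrepresentation ρ, S.toSubmodule = E := by
  refine ⟨⟨E, fun g => ?_⟩, rfl⟩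
  have hg : g ∈ Submonoid.closure s := by
    rw [← Subgroup.closure_toSubmonoid_of_isOfFinOrder hfin, hs]; trivial
  induction hg using Submonoid.closure_induction with
  | mem x hx => exact fun v hv => hE x hx v hv
  | one => intro v hv; simpa using hv
  | mul x y _ _ hx hy => intro v hv; rw [map_mul]; exact hx (hy hv)

theorem IsPrimitiveRoot.pow_eq_pow_of_modEq {R : Type*} [CommMonoid R] {ξ : R} {D i j : ℕ}
    (h : IsPrimitiveRoot ξ D) (hij : i ≡ j [MOD D]) : ξ ^ i = ξ ^ j := by
  rw [pow_eq_pow_mod i h.pow_eq_one, pow_eq_pow_mod j h.pow_eq_one, hij]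

theorem IsPrimitiveRoot.modEq_of_pow_eq_pow {R : Type*} [CommMonoid R] {ξ : R} {D i j : ℕ}
    (h : IsPrimitiveRoot ξ D) (hD : 0 < D) (hij : ξ ^ i = ξ ^ j) : i ≡ j [MOD D] := by
  rw [pow_eq_pow_mod i h.pow_eq_one, pow_eq_pow_mod j h.pow_eq_one] at hij
  exact h.pow_inj (Nat.mod_lt _ hD) (Nat.mod_lt _ hD) hij

/-- An endomorphism of a finite-dimensional complex space has an eigenvector in each nonzero
stable subspace. -/
theorem exists_eigenvector_mem {V : Type*} [AddCommGroup V] [Module ℂ V] [FiniteDimensional ℂ V]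
    (f : Module.End ℂ V) (E : Submodule ℂ V) (hE : ∃ v ∈ E, v ≠ 0) (hf : ∀ v ∈ E, f v ∈ E) :
    ∃ c : ℂ, ∃ v ∈ E, v ≠ 0 ∧ f v = c • v := by
  obtain ⟨v₀, hv₀, hne⟩ := hE
  have : Nontrivial E := ⟨⟨v₀, hv₀⟩, 0, fun h => hne (congrArg Subtype.val h)⟩
  obtain ⟨c, hc⟩ := Module.End.exists_eigenvalue (f.restrict hf)
  obtain ⟨w, hw⟩ := hc.exists_hasEigenvector
  refine ⟨c, w, w.2, fun h => hw.2 (Subtype.ext h), ?_⟩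
  exact congrArg Subtype.val hw.apply_eq_smul

namespace Representation

variable {G R V : Type*} [Group G] [CommRing R] [AddCommGroup V] [Module R V]
  (σ : Representation R G V)

theorem pow_apply_of_eigenvector {g : G} {v : V} {μ : R} (h : σ g v = μ • v) (i : ℕ) :
    σ (g ^ i) v = μ ^ i • v := by
  induction i with
  | zero => simp
  | succ i ih => rw [pow_succ, map_mul, Module.End.mul_apply, h, map_smul, ih, smul_smul, pow_succ']

theorem apply_apply_of_rel {a b : G} {r : ℕ} (hab : a * b = b * a ^ r) {v : V} {μ : R}
    (h : σ a v = μ • v) (j : ℕ) : σ a (σ (b ^ j) v) = μ ^ r ^ j • σ (b ^ j) v := by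
  rw [← Module.End.mul_apply, ← map_mul, mul_pow_eq_of_rel hab, map_mul, Module.End.mul_apply,
    σ.pow_apply_of_eigenvector h, map_smul]

theorem apply_ne_zero {v : V} (hv : v ≠ 0) (g : G) : σ g v ≠ 0 := fun h => hv <| by
  rw [← σ.inv_self_apply g v, h, map_zero]

end Representation

/-! ### Monomial complex representations and joint eigenvectors -/

namespace HolomorphGenerators

variable {p n r : ℕ} {G : Type v} [Group G] {a b : G} {ζ : ℂ}

theorem pow_pos (H : HolomorphGenerators p n r a b ζ) (k : ℕ) : 0 < p ^ k :=
  Nat.pow_pos H.prime.pos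

theorem totient_pos (H : HolomorphGenerators p n r a b ζ) (k : ℕ) : 0 < Nat.totient (p ^ k) :=
  Nat.totient_pos.mpr (H.pow_pos k)

theorem totient_mul_div (_H : HolomorphGenerators p n r a b ζ) {k : ℕ} (hk : k ≤ n) :
    Nat.totient (p ^ k) * (Nat.totient (p ^ n) / Nat.totient (p ^ k)) = Nat.totient (p ^ n) :=
  Nat.mul_div_cancel' (Nat.totient_dvd_of_dvd (pow_dvd_pow p hk))

theorem pow_a (H : HolomorphGenerators p n r a b ζ) : a ^ p ^ n = 1 := H.pres.relations.1

theorem pow_b (H : HolomorphGenerators p n r a b ζ) : b ^ Nat.totient (p ^ n) = 1 :=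
  H.pres.relations.2.1

theorem rel (H : HolomorphGenerators p n r a b ζ) : a * b = b * a ^ r := H.pres.relations.2.2

theorem closure_eq_top (H : HolomorphGenerators p n r a b ζ) :
    Subgroup.closure {a, b} = ⊤ := H.pres.closure_eq_top

theorem isOfFinOrder (H : HolomorphGenerators p n r a b ζ) :
    ∀ g ∈ ({a, b} : Set G), IsOfFinOrder g := by
  rintro x (rfl | rfl)
  · exact isOfFinOrder_iff_pow_eq_one.mpr ⟨_, H.pow_pos n, H.pow_a⟩
  · exact isOfFinOrder_iff_pow_eq_one.mpr ⟨_, H.totient_pos n, H.pow_b⟩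

theorem isPrimitiveRoot (H : HolomorphGenerators p n r a b ζ) {k : ℕ} (hk : k ≤ n) :
    IsPrimitiveRoot (ζ ^ p ^ (n - k)) (p ^ k) :=
  H.root.pow (H.pow_pos n) (by rw [← pow_add, Nat.sub_add_cancel hk])

theorem coprime (H : HolomorphGenerators p n r a b ζ) (k : ℕ) : r.Coprime (p ^ k) := by
  have h := coprime_of_orderOf_pos (by rw [H.order]; exact H.totient_pos n)
  exact Nat.Coprime.pow_right k (Nat.Coprime.coprime_dvd_right (dvd_pow_self p (by
    have := H.pos; omega)) h)

theorem orderOf_eq (H : HolomorphGenerators p n r a b ζ) {k : ℕ} (hk : k ≤ n) :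
    orderOf (r : ZMod (p ^ k)) = Nat.totient (p ^ k) :=
  orderOf_natCast_eq_totient_of_dvd (H.pow_pos n) H.order (pow_dvd_pow p hk)

theorem pow_modEq_one_iff (H : HolomorphGenerators p n r a b ζ) {k : ℕ} (hk : k ≤ n) (i : ℕ) :
    r ^ i ≡ 1 [MOD p ^ k] ↔ Nat.totient (p ^ k) ∣ i := by
  rw [← ZMod.natCast_eq_natCast_iff, ← H.orderOf_eq hk, orderOf_dvd_iff_pow_eq_one]
  simp

theorem pow_modEq_pow_iff (H : HolomorphGenerators p n r a b ζ) {k : ℕ} (hk : k ≤ n) {i j : ℕ}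
    (hi : i < Nat.totient (p ^ k)) (hj : j < Nat.totient (p ^ k)) :
    r ^ i ≡ r ^ j [MOD p ^ k] ↔ i = j := by
  refine ⟨fun h => ?_, fun h => h ▸ rfl⟩
  wlog hij : i ≤ j generalizing i j
  · exact (this hj hi h.symm (by omega)).symm
  have h1 : r ^ i * 1 ≡ r ^ i * r ^ (j - i) [MOD p ^ k] := by
    rwa [mul_one, ← pow_add, Nat.add_sub_cancel' hij]
  have h2 := Nat.ModEq.cancel_left_of_coprime
    (Nat.Coprime.pow_right i (H.coprime k).symm) h1
  have h3 := (H.pow_modEq_one_iff hk _).mp h2.symm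
  have := Nat.eq_zero_of_dvd_of_lt h3 (by omega)
  omega

theorem root_pow_pow_totient (H : HolomorphGenerators p n r a b ζ) {k : ℕ} (hk : k ≤ n) :
    (ζ ^ p ^ (n - k)) ^ r ^ Nat.totient (p ^ k) = ζ ^ p ^ (n - k) := by
  have := (H.isPrimitiveRoot hk).pow_eq_pow_of_modEq ((H.pow_modEq_one_iff hk _).mpr dvd_rfl)
  rwa [pow_one] at this

/-- Since `b ^ φ(p ^ k)` acts as the scalar `ω`, the condition on `ω` is what `b ^ φ(p ^ n) = 1`
demands. The value `k = 0` is allowed and gives the representations of degree `1`, so both kinds are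
treated together. -/
theorem exists_stdRep (H : HolomorphGenerators p n r a b ζ) {k : ℕ} (hk : k ≤ n) {ω : ℂ}
    (hω : ω ^ (Nat.totient (p ^ n) / Nat.totient (p ^ k)) = 1) :
    ∃ ρ : Representation ℂ G (Fin (Nat.totient (p ^ k)) → ℂ),
      ρ a = diagonalEnd _ r ((ζ ^ p ^ (n - k)) • 1) ∧ ρ b = cyclicShiftEnd _ (ω • 1) := by
  refine H.pres.exists_monomial_representation (H.pow_pos n) (H.totient_pos n)
    (H.totient_mul_div hk) ?_ ?_ ?_
  · rw [smul_pow, one_pow, ← pow_mul, mul_comm, pow_mul, H.root.pow_eq_one, one_pow, one_smul]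
  · rw [smul_pow, one_pow, hω, one_smul]
  · rw [smul_pow, one_pow, H.root_pow_pow_totient hk]
    simp [mul_comm, smul_smul]

/-- The monomial representation of degree `φ (p ^ k)` with parameter `ω`. -/
def stdRep (H : HolomorphGenerators p n r a b ζ) {k : ℕ} (hk : k ≤ n) {ω : ℂ}
    (hω : ω ^ (Nat.totient (p ^ n) / Nat.totient (p ^ k)) = 1) :
    Representation ℂ G (Fin (Nat.totient (p ^ k)) → ℂ) :=
  (H.exists_stdRep hk hω).choose

section

variable {k : ℕ} {ω : ℂ}

theorem stdRep_a (H : HolomorphGenerators p n r a b ζ) (hk : k ≤ n)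
    (hω : ω ^ (Nat.totient (p ^ n) / Nat.totient (p ^ k)) = 1) :
    H.stdRep hk hω a = diagonalEnd _ r ((ζ ^ p ^ (n - k)) • 1) :=
  (H.exists_stdRep hk hω).choose_spec.1

theorem stdRep_b (H : HolomorphGenerators p n r a b ζ) (hk : k ≤ n)
    (hω : ω ^ (Nat.totient (p ^ n) / Nat.totient (p ^ k)) = 1) :
    H.stdRep hk hω b = cyclicShiftEnd _ (ω • 1) :=
  (H.exists_stdRep hk hω).choose_spec.2

theorem stdRep_a_apply (H : HolomorphGenerators p n r a b ζ) (hk : k ≤ n)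
    (hω : ω ^ (Nat.totient (p ^ n) / Nat.totient (p ^ k)) = 1)
    (v : Fin (Nat.totient (p ^ k)) → ℂ) (j : Fin (Nat.totient (p ^ k))) :
    H.stdRep hk hω a v j = (ζ ^ p ^ (n - k)) ^ r ^ (j : ℕ) * v j := by
  rw [stdRep_a, diagonalEnd_apply, smul_pow, one_pow]
  rfl

theorem stdRep_a_single (H : HolomorphGenerators p n r a b ζ) (hk : k ≤ n)
    (hω : ω ^ (Nat.totient (p ^ n) / Nat.totient (p ^ k)) = 1)
    (j : Fin (Nat.totient (p ^ k))) (x : ℂ) :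
    H.stdRep hk hω a (Pi.single j x) = (ζ ^ p ^ (n - k)) ^ r ^ (j : ℕ) • Pi.single j x := by
  ext i
  rw [stdRep_a_apply, Pi.smul_apply, smul_eq_mul]
  by_cases hi : i = j
  · rw [hi]
  · rw [Pi.single_eq_of_ne hi, mul_zero, mul_zero]

theorem stdRep_b_pow (H : HolomorphGenerators p n r a b ζ) (hk : k ≤ n)
    (hω : ω ^ (Nat.totient (p ^ n) / Nat.totient (p ^ k)) = 1)
    (v : Fin (Nat.totient (p ^ k)) → ℂ) :
    H.stdRep hk hω (b ^ Nat.totient (p ^ k)) v = ω • v := by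
  rw [map_pow, stdRep_b, cyclicShiftEnd_pow_self]
  rfl

theorem stdRep_b_pow_single (H : HolomorphGenerators p n r a b ζ) (hk : k ≤ n)
    (hω : ω ^ (Nat.totient (p ^ n) / Nat.totient (p ^ k)) = 1) {j t : ℕ}
    (hjt : j + t < Nat.totient (p ^ k)) (x : ℂ) :
    H.stdRep hk hω (b ^ t) (Pi.single ⟨j, by omega⟩ x) = Pi.single ⟨j + t, hjt⟩ x := by
  rw [map_pow, stdRep_b, cyclicShiftEnd_pow_single]

/-- The universal property of the monomial representation. -/
theorem exists_intertwiningMap_stdRep (H : HolomorphGenerators p n r a b ζ) (hk : k ≤ n)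
    (hω : ω ^ (Nat.totient (p ^ n) / Nat.totient (p ^ k)) = 1) {U : Type*} [AddCommGroup U]
    [Module ℂ U] (σ : Representation ℂ G U) {v : U} (hva : σ a v = (ζ ^ p ^ (n - k)) • v)
    (hvb : σ (b ^ Nat.totient (p ^ k)) v = ω • v) :
    ∃ Φ : Representation.IntertwiningMap (H.stdRep hk hω) σ,
      Φ (Pi.single ⟨0, H.totient_pos k⟩ 1) = v := by
  let F : (Fin (Nat.totient (p ^ k)) → ℂ) →ₗ[ℂ] U :=
    Fintype.linearCombination ℂ fun j => σ (b ^ (j : ℕ)) v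
  have hF : ∀ j x, F (Pi.single j x) = x • σ (b ^ (j : ℕ)) v := fun j x => by
    simp [F, Fintype.linearCombination_apply_single]
  have hFa : F ∘ₗ H.stdRep hk hω a = σ a ∘ₗ F := by
    refine LinearMap.pi_ext fun j x => ?_
    rw [LinearMap.comp_apply, LinearMap.comp_apply, stdRep_a_single, map_smul, hF, map_smul,
      σ.apply_apply_of_rel H.rel hva, smul_comm]
  have hFb : F ∘ₗ H.stdRep hk hω b = σ b ∘ₗ F := by
    refine LinearMap.pi_ext fun j x => ?_
    rw [LinearMap.comp_apply, LinearMap.comp_apply, hF, map_smul, ← Module.End.mul_apply, ← map_mul,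
      ← pow_succ', stdRep_b]
    by_cases hj : (j : ℕ) + 1 < Nat.totient (p ^ k)
    · have := cyclicShiftEnd_single (ω • 1 : Module.End ℂ ℂ) hj x
      rw [Fin.eta] at this
      rw [this, hF]
    · have hj' : j = ⟨Nat.totient (p ^ k) - 1, by have := j.2; omega⟩ :=
        Fin.ext (by simp only; have := j.2; omega)
      have h1 : (j : ℕ) + 1 = Nat.totient (p ^ k) := by have := j.2; omega
      rw [h1, hvb, hj', cyclicShiftEnd_single_last _ (H.totient_pos k), hF]
      simp only [LinearMap.smul_apply, Module.End.one_apply, smul_eq_mul, pow_zero, map_one]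
      rw [mul_smul, smul_comm]
  obtain ⟨Φ, hΦ⟩ := exists_intertwiningMap_of_closure H.closure_eq_top F (ρ := H.stdRep hk hω)
    (σ := σ) (by
      rintro g (rfl | rfl) w
      · exact LinearMap.congr_fun hFa w
      · exact LinearMap.congr_fun hFb w)
  exact ⟨Φ, by rw [hΦ, hF]; simp⟩

end

/-- A nonzero finite-dimensional complex representation contains a joint eigenvector of `a` and a
power of `b`, which generates a monomial subrepresentation. -/
theorem exists_joint_eigenvector (H : HolomorphGenerators p n r a b ζ) {U : Type*}
    [AddCommGroup U] [Module ℂ U] [FiniteDimensional ℂ U] [Nontrivial U]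
    (σ : Representation ℂ G U) :
    ∃ k ≤ n, ∃ ω : ℂ, ω ^ (Nat.totient (p ^ n) / Nat.totient (p ^ k)) = 1 ∧
      ∃ v ≠ 0, σ a v = (ζ ^ p ^ (n - k)) • v ∧ σ (b ^ Nat.totient (p ^ k)) v = ω • v := by
  obtain ⟨w, hw⟩ := exists_ne (0 : U)
  obtain ⟨μ, v, -, hv, hav⟩ := exists_eigenvector_mem (σ a) ⊤ ⟨w, trivial, hw⟩ fun _ _ => trivial
  have hμ : μ ^ p ^ n = 1 := by
    have h := σ.pow_apply_of_eigenvector hav (p ^ n)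
    rw [H.pow_a, map_one, Module.End.one_apply] at h
    by_contra hne
    have : (μ ^ p ^ n - 1) • v = 0 := by rw [sub_smul, one_smul, ← h, sub_self]
    exact (smul_ne_zero (sub_ne_zero.mpr hne) hv) this
  obtain ⟨k, hk, hord⟩ := (Nat.dvd_prime_pow H.prime).mp (orderOf_dvd_of_pow_eq_one hμ)
  have hμk : IsPrimitiveRoot μ (p ^ k) := hord ▸ IsPrimitiveRoot.orderOf μ
  have : NeZero (p ^ k) := ⟨(H.pow_pos k).ne'⟩
  obtain ⟨t, -, ht, hξ⟩ := hμk.isPrimitiveRoot_iff.mp (H.isPrimitiveRoot hk)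
  -- The prescribed root `ξ` is `μ ^ t` with `t` prime to `p ^ k`, hence `μ ^ r ^ j` for some `j`;
  -- applying `b ^ j` moves the eigenvector into the `ξ`-eigenspace.
  obtain ⟨j, hj⟩ := exists_pow_modEq_of_orderOf_eq_totient (H.pow_pos n) H.order
    (pow_dvd_pow p hk) ht
  have hau : σ a (σ (b ^ j) v) = (ζ ^ p ^ (n - k)) • σ (b ^ j) v := by
    rw [σ.apply_apply_of_rel H.rel hav, ← hξ, hμk.pow_eq_pow_of_modEq hj]
  -- The `ξ`-eigenspace is stable under `b ^ φ(p ^ k)`, because `r ^ φ(p ^ k) ≡ 1` modulo `p ^ k`.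
  obtain ⟨ω, u, hu, hune, hub⟩ := exists_eigenvector_mem (σ (b ^ Nat.totient (p ^ k)))
    (Module.End.eigenspace (σ a) (ζ ^ p ^ (n - k)))
    ⟨_, Module.End.mem_eigenspace_iff.mpr hau, σ.apply_ne_zero hv _⟩ fun x hx => by
      rw [Module.End.mem_eigenspace_iff] at hx ⊢
      rw [σ.apply_apply_of_rel H.rel hx, H.root_pow_pow_totient hk]
  refine ⟨k, hk, ω, ?_, u, hune, Module.End.mem_eigenspace_iff.mp hu, hub⟩
  have h := σ.pow_apply_of_eigenvector hub (Nat.totient (p ^ n) / Nat.totient (p ^ k))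
  rw [← pow_mul, H.totient_mul_div hk, H.pow_b, map_one, Module.End.one_apply] at h
  by_contra hne
  have : (ω ^ (Nat.totient (p ^ n) / Nat.totient (p ^ k)) - 1) • u = 0 := by
    rw [sub_smul, one_smul, ← h, sub_self]
  exact (smul_ne_zero (sub_ne_zero.mpr hne) hune) this

end HolomorphGenerators

/-! ### Classification of the complex irreducible representations -/

namespace Representation

variable {G R V : Type*} [Group G] [Field R] [AddCommGroup V] [Module R V]
  {ρ : Representation R G V}

theorem isIrreducible_of_forall [Nontrivial V]
    (h : ∀ S : Subrepresentation ρ, (∃ v ∈ S.toSubmodule, v ≠ 0) → S.toSubmodule = ⊤) :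
    ρ.IsIrreducible := by
  have hne : (⊥ : Subrepresentation ρ) ≠ ⊤ := fun h => by
    have := congrArg Subrepresentation.toSubmodule h
    exact bot_ne_top (α := Submodule R V) this
  have : Nontrivial (Subrepresentation ρ) := ⟨⊥, ⊤, hne⟩
  refine ⟨fun S => or_iff_not_imp_left.mpr fun hS => Subrepresentation.toSubmodule_injective ?_⟩
  refine h S (Submodule.exists_mem_ne_zero_of_ne_bot fun hb => hS ?_)
  exact Subrepresentation.toSubmodule_injective hb

theorem IsIrreducible.nontrivial (h : ρ.IsIrreducible) : Nontrivial V := by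
  by_contra hn
  rw [not_nontrivial_iff_subsingleton] at hn
  obtain ⟨S, T, hST⟩ := h.toNontrivial
  exact hST (Subrepresentation.toSubmodule_injective (Subsingleton.elim _ _))

end Representation

theorem Irrep.nontrivial {k : Type u} [Field k] {G : Type v} [Group G] (X : Irrep k G) :
    Nontrivial X.V :=
  X.irreducible.nontrivial

namespace HolomorphGenerators

variable {p n r : ℕ} {G : Type v} [Group G] {a b : G} {ζ : ℂ}

/-- The order of the root determines the level `k`, and the exponents `r ^ j` with `j < φ(p ^ k)`
are distinct modulo `p ^ k`. Thus each standard root is an eigenvalue of `a` at one level only, with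
multiplicity one. -/
theorem pow_root_eq_iff (H : HolomorphGenerators p n r a b ζ) {k k' : ℕ} (hk : k ≤ n)
    (hk' : k' ≤ n) {j : ℕ} (hj : j < Nat.totient (p ^ k)) :
    (ζ ^ p ^ (n - k)) ^ r ^ j = ζ ^ p ^ (n - k') ↔ k = k' ∧ j = 0 := by
  constructor
  · intro h
    have h1 : IsPrimitiveRoot ((ζ ^ p ^ (n - k)) ^ r ^ j) (p ^ k) :=
      (H.isPrimitiveRoot hk).pow_of_coprime _ (Nat.Coprime.pow_left j (H.coprime k))
    rw [h] at h1
    have hkk : k = k' := Nat.pow_right_injective H.prime.two_le (h1.unique (H.isPrimitiveRoot hk'))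
    subst hkk
    refine ⟨rfl, ?_⟩
    refine (H.pow_modEq_pow_iff hk hj (H.totient_pos k)).mp
      ((H.isPrimitiveRoot hk).modEq_of_pow_eq_pow (H.pow_pos k) ?_)
    rw [h, pow_zero, pow_one]
  · rintro ⟨rfl, rfl⟩
    rw [pow_zero, pow_one]

section

variable {k k' : ℕ} {ω ω' : ℂ}

theorem eq_single_of_stdRep_a (H : HolomorphGenerators p n r a b ζ) (hk : k ≤ n) (hk' : k' ≤ n)
    (hω : ω ^ (Nat.totient (p ^ n) / Nat.totient (p ^ k)) = 1)
    {v : Fin (Nat.totient (p ^ k)) → ℂ} (hv : v ≠ 0)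
    (h : H.stdRep hk hω a v = (ζ ^ p ^ (n - k')) • v) :
    k = k' ∧ v = Pi.single ⟨0, H.totient_pos k⟩ (v ⟨0, H.totient_pos k⟩) := by
  have key : ∀ j, v j ≠ 0 → k = k' ∧ (j : ℕ) = 0 := fun j hj => by
    have := congrFun h j
    rw [stdRep_a_apply, Pi.smul_apply, smul_eq_mul] at this
    exact (H.pow_root_eq_iff hk hk' j.2).mp (mul_right_cancel₀ hj this)
  obtain ⟨j, hj⟩ := Function.ne_iff.mp hv
  refine ⟨(key j hj).1, funext fun i => ?_⟩
  by_cases hi : i = ⟨0, H.totient_pos k⟩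
  · rw [hi, Pi.single_eq_same]
  · rw [Pi.single_eq_of_ne hi]
    by_contra hne
    exact hi (Fin.ext (key i hne).2)

theorem stdRep_joint_eigenvector (H : HolomorphGenerators p n r a b ζ) (hk : k ≤ n)
    (hk' : k' ≤ n) (hω : ω ^ (Nat.totient (p ^ n) / Nat.totient (p ^ k)) = 1)
    {v : Fin (Nat.totient (p ^ k)) → ℂ} (hv : v ≠ 0)
    (ha : H.stdRep hk hω a v = (ζ ^ p ^ (n - k')) • v)
    (hb : H.stdRep hk hω (b ^ Nat.totient (p ^ k')) v = ω' • v) : k = k' ∧ ω = ω' := by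
  obtain ⟨rfl, -⟩ := H.eq_single_of_stdRep_a hk hk' hω hv ha
  refine ⟨rfl, ?_⟩
  rw [stdRep_b_pow] at hb
  exact smul_left_injective ℂ hv hb

/-- A nonzero subrepresentation contains a joint eigenvector, which must be a multiple of the first
basis vector; powers of `b` carry that vector to all the others. -/
theorem stdRep_isIrreducible (H : HolomorphGenerators p n r a b ζ) (hk : k ≤ n)
    (hω : ω ^ (Nat.totient (p ^ n) / Nat.totient (p ^ k)) = 1) :
    (H.stdRep hk hω).IsIrreducible := by
  have : Nonempty (Fin (Nat.totient (p ^ k))) := ⟨⟨0, H.totient_pos k⟩⟩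
  refine Representation.isIrreducible_of_forall fun S ⟨w, hwS, hw⟩ => ?_
  have : Nontrivial S.toSubmodule := ⟨⟨w, hwS⟩, 0, fun h => hw (congrArg Subtype.val h)⟩
  obtain ⟨k', hk', ω', -, v, hv, hva, -⟩ := H.exists_joint_eigenvector S.toRepresentation
  have hv' : (v : Fin (Nat.totient (p ^ k)) → ℂ) ≠ 0 := fun h => hv (Subtype.ext h)
  obtain ⟨-, hsingle⟩ := H.eq_single_of_stdRep_a hk hk' hω hv' (congrArg Subtype.val hva)
  set c := (v : Fin (Nat.totient (p ^ k)) → ℂ) ⟨0, H.totient_pos k⟩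
  have hc : c ≠ 0 := fun h => hv' (by rw [hsingle, h, Pi.single_zero])
  have hmem : ∀ j x, (Pi.single j x : Fin (Nat.totient (p ^ k)) → ℂ) ∈ S.toSubmodule := by
    intro j x
    have h1 := S.apply_mem_toSubmodule (b ^ (j : ℕ)) (S.toSubmodule.smul_mem (c⁻¹ * x) v.2)
    have h2 := H.stdRep_b_pow_single hk hω (j := 0) (t := j) (by simp) x
    simp only [zero_add] at h2
    rw [hsingle, ← Pi.single_smul, smul_eq_mul, mul_right_comm, inv_mul_cancel₀ hc, one_mul, h2]
      at h1
    exact h1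
  rw [eq_top_iff]
  intro x _
  rw [← Finset.univ_sum_single x]
  exact Submodule.sum_mem _ fun j _ => hmem j _

/-- The monomial representation as an irreducible representation. -/
def stdIrrep (H : HolomorphGenerators p n r a b ζ) (hk : k ≤ n)
    (hω : ω ^ (Nat.totient (p ^ n) / Nat.totient (p ^ k)) = 1) : Irrep ℂ G where
  V := Fin (Nat.totient (p ^ k)) → ℂ
  ρ := H.stdRep hk hω
  irreducible := H.stdRep_isIrreducible hk hω

/-- The isomorphism class of the monomial representation. -/
def stdClass (H : HolomorphGenerators p n r a b ζ) (hk : k ≤ n)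
    (hω : ω ^ (Nat.totient (p ^ n) / Nat.totient (p ^ k)) = 1) : IrrepClass ℂ G :=
  Quotient.mk _ (H.stdIrrep hk hω)

theorem nonempty_equiv_stdRep (H : HolomorphGenerators p n r a b ζ) (hk : k ≤ n)
    (hω : ω ^ (Nat.totient (p ^ n) / Nat.totient (p ^ k)) = 1) :
    Nonempty ((H.stdClass hk hω).out.ρ.Equiv (H.stdRep hk hω)) :=
  Quotient.mk_out (H.stdIrrep hk hω)

theorem stdClass_character (H : HolomorphGenerators p n r a b ζ) (hk : k ≤ n)
    (hω : ω ^ (Nat.totient (p ^ n) / Nat.totient (p ^ k)) = 1) :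
    (H.stdClass hk hω).character = (H.stdRep hk hω).character := rfl

theorem stdClass_degree (H : HolomorphGenerators p n r a b ζ) (hk : k ≤ n)
    (hω : ω ^ (Nat.totient (p ^ n) / Nat.totient (p ^ k)) = 1) :
    (H.stdClass hk hω).degree = Nat.totient (p ^ k) := by
  change Module.finrank ℂ (Fin (Nat.totient (p ^ k)) → ℂ) = _
  simp

/-- This is Frobenius reciprocity: the monomial representation is induced from the character `a ↦
ξ`, `b ^ φ(p ^ k) ↦ ω` of the subgroup generated by these two elements. -/
theorem exists_stdClass_ne_zero_iff (H : HolomorphGenerators p n r a b ζ) (hk : k ≤ n)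
    (hω : ω ^ (Nat.totient (p ^ n) / Nat.totient (p ^ k)) = 1) {U : Type*} [AddCommGroup U]
    [Module ℂ U] (σ : Representation ℂ G U) :
    (∃ f : Representation.IntertwiningMap (H.stdClass hk hω).out.ρ σ, f ≠ 0) ↔
      ∃ v ≠ 0, σ a v = (ζ ^ p ^ (n - k)) • v ∧ σ (b ^ Nat.totient (p ^ k)) v = ω • v := by
  obtain ⟨e⟩ := H.nonempty_equiv_stdRep hk hω
  have := H.stdRep_isIrreducible hk hω
  constructor
  · rintro ⟨f, hf⟩
    let g := f.comp e.symm.toIntertwiningMap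
    have hg : g ≠ 0 := fun h => hf <| by
      ext v
      have := DFunLike.congr_fun h (e v)
      simpa [g] using this
    have hinj := (Representation.IsIrreducible.injective_or_eq_zero g).resolve_right hg
    refine ⟨g (Pi.single ⟨0, H.totient_pos k⟩ 1), fun h => ?_, ?_, ?_⟩
    · have h0 := hinj (h.trans (map_zero g).symm)
      have h1 := congrFun h0 ⟨0, H.totient_pos k⟩
      simp at h1
    · rw [← g.isIntertwining, stdRep_a_single, map_smul, pow_zero, pow_one]
    · rw [← g.isIntertwining, stdRep_b_pow, map_smul]
  · rintro ⟨v, hv, ha, hb⟩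
    obtain ⟨Φ, hΦ⟩ := H.exists_intertwiningMap_stdRep hk hω σ ha hb
    refine ⟨Φ.comp e.toIntertwiningMap, fun h => hv ?_⟩
    have := DFunLike.congr_fun h (e.symm (Pi.single ⟨0, H.totient_pos k⟩ 1))
    simpa [hΦ] using this

theorem exists_eq_stdClass (H : HolomorphGenerators p n r a b ζ) (x : IrrepClass ℂ G) :
    ∃ k, ∃ hk : k ≤ n, ∃ ω : ℂ, ∃ hω : ω ^ (Nat.totient (p ^ n) / Nat.totient (p ^ k)) = 1,
      x = H.stdClass hk hω := by
  induction x using Quotient.inductionOn with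
  | h X =>
  have := X.nontrivial
  obtain ⟨k, hk, ω, hω, v, hv, ha, hb⟩ := H.exists_joint_eigenvector X.ρ
  refine ⟨k, hk, ω, hω, Quotient.sound ?_⟩
  obtain ⟨Φ, hΦ⟩ := H.exists_intertwiningMap_stdRep hk hω X.ρ ha hb
  have h1 := H.stdRep_isIrreducible hk hω
  have h2 := X.irreducible
  have hbij := (Representation.IsIrreducible.bijective_or_eq_zero Φ).resolve_right fun h =>
    hv (by rw [← hΦ, h]; rfl)
  exact ⟨(Φ.ofBijective hbij).symm⟩

theorem stdClass_inj (H : HolomorphGenerators p n r a b ζ) (hk : k ≤ n)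
    (hω : ω ^ (Nat.totient (p ^ n) / Nat.totient (p ^ k)) = 1) (hk' : k' ≤ n)
    (hω' : ω' ^ (Nat.totient (p ^ n) / Nat.totient (p ^ k')) = 1) :
    H.stdClass hk hω = H.stdClass hk' hω' ↔ k = k' ∧ ω = ω' := by
  constructor
  · intro h
    obtain ⟨e⟩ := Quotient.exact h
    change (H.stdRep hk hω).Equiv (H.stdRep hk' hω') at e
    have he : e.toIntertwiningMap (Pi.single ⟨0, H.totient_pos k⟩ 1) ≠ 0 := by
      intro h
      have h0 := e.toLinearEquiv.injective (h.trans (map_zero e.toLinearEquiv).symm)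
      have h1 := congrFun h0 ⟨0, H.totient_pos k⟩
      simp at h1
    have := H.stdRep_joint_eigenvector hk' hk hω' (ω' := ω) he
      (by rw [← Representation.IntertwiningMap.isIntertwining, stdRep_a_single, map_smul, pow_zero,
            pow_one])
      (by rw [← Representation.IntertwiningMap.isIntertwining, stdRep_b_pow, map_smul])
    exact ⟨this.1.symm, this.2.symm⟩
  · rintro ⟨rfl, rfl⟩
    rfl

end

end HolomorphGenerators

/-! ### Characters, character fields and Galois conjugates -/

namespace HolomorphGenerators

variable {p n r : ℕ} {G : Type v} [Group G] {a b : G} {ζ : ℂ}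

theorem exists_eq_pow_mul_pow (H : HolomorphGenerators p n r a b ζ) (g : G) :
    ∃ j i : ℕ, g = b ^ j * a ^ i := by
  obtain ⟨j, -, i, -, h⟩ := _root_.exists_eq_pow_mul_pow (H.pow_pos n) (H.totient_pos n) H.pow_a
    H.pow_b H.rel H.closure_eq_top g
  exact ⟨j, i, h⟩

theorem image_root_pow (H : HolomorphGenerators p n r a b ζ) {k : ℕ} (hk : k ≤ n) :
    Finset.univ.image (fun l : Fin (Nat.totient (p ^ k)) => (ζ ^ p ^ (n - k)) ^ r ^ (l : ℕ)) =
      primitiveRoots (p ^ k) ℂ := by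
  have hξ := H.isPrimitiveRoot hk
  refine Finset.eq_of_subset_of_card_le (fun x hx => ?_) ?_
  · obtain ⟨l, -, rfl⟩ := Finset.mem_image.mp hx
    exact (mem_primitiveRoots (H.pow_pos k)).mpr
      (hξ.pow_of_coprime _ (Nat.Coprime.pow_left l (H.coprime k)))
  · rw [hξ.card_primitiveRoots, Finset.card_image_of_injective]
    · simp
    · intro i j hij
      exact Fin.ext ((H.pow_modEq_pow_iff hk i.2 j.2).mp
        (hξ.modEq_of_pow_eq_pow (H.pow_pos k) hij))

theorem sum_root_pow (H : HolomorphGenerators p n r a b ζ) {k : ℕ} (hk : k ≤ n) (f : ℂ → ℂ) :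
    ∑ l : Fin (Nat.totient (p ^ k)), f ((ζ ^ p ^ (n - k)) ^ r ^ (l : ℕ)) =
      ∑ x ∈ primitiveRoots (p ^ k) ℂ, f x := by
  rw [← H.image_root_pow hk, Finset.sum_image]
  intro i _ j _ hij
  exact Fin.ext ((H.pow_modEq_pow_iff hk i.2 j.2).mp
    ((H.isPrimitiveRoot hk).modEq_of_pow_eq_pow (H.pow_pos k) hij))

end HolomorphGenerators

theorem exists_isCyclotomicExtension_rat (D : ℕ) [NeZero D] :
    ∃ (K : Type) (_ : Field K) (_ : Algebra ℚ K), IsCyclotomicExtension {D} ℚ K :=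
  have : NeZero (D : ℚ) := ⟨Nat.cast_ne_zero.mpr (NeZero.ne D)⟩
  ⟨CyclotomicField D ℚ, inferInstance, CyclotomicField.algebra D ℚ,
    CyclotomicField.isCyclotomicExtension D ℚ⟩

/-- The sum of the `i`-th powers of the primitive `D`-th roots of unity is rational. -/
theorem exists_rat_sum_primitiveRoots_pow (D : ℕ) [NeZero D] (i : ℕ) :
    ∃ q : ℚ, ∑ x ∈ primitiveRoots D ℂ, x ^ i = algebraMap ℚ ℂ q := by
  obtain ⟨K, _, _, _⟩ := exists_isCyclotomicExtension_rat D
  have : FiniteDimensional ℚ K := IsCyclotomicExtension.finiteDimensional {D} ℚ K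
  let z := IsCyclotomicExtension.zeta D ℚ K
  have hz : IsPrimitiveRoot z D := IsCyclotomicExtension.zeta_spec D ℚ _
  have hirr := Polynomial.cyclotomic.irreducible_rat (NeZero.pos D)
  -- The embeddings of `K` into `ℂ` send `z` to each primitive root once, so the sum is a trace.
  refine ⟨Algebra.trace ℚ K (z ^ i), ?_⟩
  rw [trace_eq_sum_embeddings ℂ,
    ← (hz.embeddingsEquivPrimitiveRoots ℂ hirr).symm.sum_comp, ← Finset.sum_coe_sort]
  refine Finset.sum_congr rfl fun x _ => ?_
  rw [map_pow]
  congr 1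
  have := hz.embeddingsEquivPrimitiveRoots_apply_coe ℂ hirr
    ((hz.embeddingsEquivPrimitiveRoots ℂ hirr).symm x)
  rw [Equiv.apply_symm_apply] at this
  exact this

/-- Primitive roots of unity of the same order are Galois conjugate. -/
theorem exists_algEquiv_of_isPrimitiveRoot {d : ℕ} [NeZero d] {K : Type*} [Field K] [Algebra ℚ K]
    [IsCyclotomicExtension {d} ℚ K] {z z' : K} (h : IsPrimitiveRoot z d)
    (h' : IsPrimitiveRoot z' d) : ∃ σ : K ≃ₐ[ℚ] K, σ z = z' := by
  have : NeZero (d : ℚ) := ⟨Nat.cast_ne_zero.mpr (NeZero.ne d)⟩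
  have hirr := Polynomial.cyclotomic.irreducible_rat (NeZero.pos d)
  have hmin : minpoly ℚ (h.powerBasis ℚ).gen = minpoly ℚ (h'.powerBasis ℚ).gen := by
    rw [IsPrimitiveRoot.powerBasis_gen ℚ h, IsPrimitiveRoot.powerBasis_gen ℚ h',
      ← h.minpoly_eq_cyclotomic_of_irreducible hirr,
      ← h'.minpoly_eq_cyclotomic_of_irreducible hirr]
  refine ⟨(h.powerBasis ℚ).equivOfMinpoly (h'.powerBasis ℚ) hmin, ?_⟩
  have := (h.powerBasis ℚ).equivOfMinpoly_gen (h'.powerBasis ℚ) hmin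
  rwa [IsPrimitiveRoot.powerBasis_gen ℚ h, IsPrimitiveRoot.powerBasis_gen ℚ h'] at this

theorem exists_algEquiv_adjoin_root {d : ℕ} (hd : 0 < d) {ω ω' : ℂ} (h : IsPrimitiveRoot ω d)
    (h' : IsPrimitiveRoot ω' d) {F : IntermediateField ℚ ℂ}
    (hF : F = IntermediateField.adjoin ℚ {ω}) (hω : ω ∈ F) :
    ∃ σ : F ≃ₐ[ℚ] F, (σ ⟨ω, hω⟩ : ℂ) = ω' := by
  subst hF
  have : NeZero d := ⟨hd.ne'⟩
  have : IsCyclotomicExtension {d} ℚ (IntermediateField.adjoin ℚ {ω}) := by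
    change IsCyclotomicExtension {d} ℚ (IntermediateField.adjoin ℚ {ω}).toSubalgebra
    rw [IntermediateField.adjoin_simple_toSubalgebra_of_isAlgebraic
      (h.isIntegral hd).tower_top.isAlgebraic]
    exact h.adjoin_isCyclotomicExtension ℚ
  obtain ⟨i, -, rfl⟩ := h.eq_pow_of_pow_eq_one h'.pow_eq_one
  obtain ⟨σ, hσ⟩ := exists_algEquiv_of_isPrimitiveRoot
    (z := (⟨ω, hω⟩ : IntermediateField.adjoin ℚ {ω})) (z' := ⟨ω, hω⟩ ^ i)
    (IsPrimitiveRoot.coe_submonoidClass_iff.mp h) (IsPrimitiveRoot.coe_submonoidClass_iff.mp h')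
  exact ⟨σ, congrArg Subtype.val hσ⟩

namespace HolomorphGenerators

variable {p n r : ℕ} {G : Type v} [Group G] {a b : G} {ζ : ℂ}

section

variable {k k' : ℕ} {ω ω' : ℂ}

/-- The shifted vector is an eigenvector of `a` for the `r ^ j`-th power of the old eigenvalue. Its
`l`-th coordinate can survive only if the eigenvalue is unchanged, that is, if `φ(p ^ k) ∣ j`. -/
theorem stdRep_b_pow_single_self (H : HolomorphGenerators p n r a b ζ) (hk : k ≤ n)
    (hω : ω ^ (Nat.totient (p ^ n) / Nat.totient (p ^ k)) = 1) (j : ℕ)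
    (l : Fin (Nat.totient (p ^ k))) :
    H.stdRep hk hω (b ^ j) (Pi.single l 1) l =
      if Nat.totient (p ^ k) ∣ j then ω ^ (j / Nat.totient (p ^ k)) else 0 := by
  split_ifs with h
  · obtain ⟨q, rfl⟩ := h
    rw [pow_mul, Representation.pow_apply_of_eigenvector _ (H.stdRep_b_pow hk hω _),
      Nat.mul_div_cancel_left _ (H.totient_pos k), Pi.smul_apply, Pi.single_eq_same, smul_eq_mul,
      mul_one]
  · have h1 := congrFun (Representation.apply_apply_of_rel _ H.rel
      (H.stdRep_a_single hk hω l 1) j) l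
    rw [stdRep_a_apply, Pi.smul_apply, smul_eq_mul] at h1
    by_contra hne
    have h2 := mul_right_cancel₀ hne h1
    rw [← pow_mul (ζ ^ p ^ (n - k))] at h2
    have h3 := (H.isPrimitiveRoot hk).modEq_of_pow_eq_pow (H.pow_pos k) h2
    refine h ((H.pow_modEq_one_iff hk j).mp (Nat.ModEq.cancel_left_of_coprime (c := r ^ (l : ℕ))
      (Nat.Coprime.pow_right _ (H.coprime k).symm) ?_))
    rw [mul_one]
    exact h3.symm

theorem stdRep_character (H : HolomorphGenerators p n r a b ζ) (hk : k ≤ n)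
    (hω : ω ^ (Nat.totient (p ^ n) / Nat.totient (p ^ k)) = 1) (j i : ℕ) :
    (H.stdRep hk hω).character (b ^ j * a ^ i) =
      (if Nat.totient (p ^ k) ∣ j then ω ^ (j / Nat.totient (p ^ k)) else 0) *
        ∑ x ∈ primitiveRoots (p ^ k) ℂ, x ^ i := by
  rw [Representation.character, LinearMap.trace_eq_matrix_trace ℂ (Pi.basisFun ℂ _), Matrix.trace,
    ← H.sum_root_pow hk (fun x => x ^ i), Finset.mul_sum]
  refine Finset.sum_congr rfl fun l _ => ?_
  rw [Matrix.diag_apply, LinearMap.toMatrix_apply, Pi.basisFun_repr, Pi.basisFun_apply, map_mul,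
    Module.End.mul_apply, Representation.pow_apply_of_eigenvector _ (H.stdRep_a_single hk hω l 1),
    map_smul, Pi.smul_apply, stdRep_b_pow_single_self, smul_eq_mul, mul_comm]

/-- The numbers `q` and `j` are independent of `ω`, so applying an automorphism to `ω` applies it to
the whole character. -/
theorem exists_rat_stdRep_character (H : HolomorphGenerators p n r a b ζ) (hk : k ≤ n) (g : G) :
    ∃ q : ℚ, ∃ j : ℕ, ∀ (ω : ℂ) (hω : ω ^ (Nat.totient (p ^ n) / Nat.totient (p ^ k)) = 1),
      (H.stdRep hk hω).character g = ω ^ j * algebraMap ℚ ℂ q := by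
  obtain ⟨j, i, rfl⟩ := H.exists_eq_pow_mul_pow g
  have : NeZero (p ^ k) := ⟨(H.pow_pos k).ne'⟩
  obtain ⟨q, hq⟩ := exists_rat_sum_primitiveRoots_pow (p ^ k) i
  by_cases h : Nat.totient (p ^ k) ∣ j
  · exact ⟨q, j / Nat.totient (p ^ k), fun ω hω => by rw [stdRep_character, if_pos h, hq]⟩
  · exact ⟨0, 0, fun ω hω => by rw [stdRep_character, if_neg h]; simp⟩

theorem stdRep_character_b_pow (H : HolomorphGenerators p n r a b ζ) (hk : k ≤ n)
    (hω : ω ^ (Nat.totient (p ^ n) / Nat.totient (p ^ k)) = 1) :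
    (H.stdRep hk hω).character (b ^ Nat.totient (p ^ k)) = Nat.totient (p ^ k) * ω := by
  have := H.stdRep_character hk hω (Nat.totient (p ^ k)) 0
  rw [pow_zero, mul_one, if_pos dvd_rfl, Nat.div_self (H.totient_pos k), pow_one] at this
  rw [this, mul_comm]
  simp [(H.isPrimitiveRoot hk).card_primitiveRoots]

theorem stdClass_charField (H : HolomorphGenerators p n r a b ζ) (hk : k ≤ n)
    (hω : ω ^ (Nat.totient (p ^ n) / Nat.totient (p ^ k)) = 1) :
    (H.stdClass hk hω).charField = IntermediateField.adjoin ℚ {ω} := by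
  apply le_antisymm
  · refine IntermediateField.adjoin_le_iff.mpr ?_
    rintro _ ⟨g, rfl⟩
    obtain ⟨q, j, h⟩ := H.exists_rat_stdRep_character hk g
    rw [stdClass_character, h ω hω]
    exact mul_mem (pow_mem (IntermediateField.mem_adjoin_simple_self ℚ ω) j)
      (IntermediateField.algebraMap_mem _ q)
  · refine IntermediateField.adjoin_simple_le_iff.mpr ?_
    have h1 := (H.stdClass hk hω).character_mem_charField (b ^ Nat.totient (p ^ k))
    rw [stdClass_character, stdRep_character_b_pow] at h1
    have h2 := mul_mem (inv_mem (natCast_mem (H.stdClass hk hω).charField (Nat.totient (p ^ k)))) h1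
    rwa [inv_mul_cancel_left₀ (Nat.cast_ne_zero.mpr (H.totient_pos k).ne')] at h2

/-- Oddness of `p` is essential, since `φ(1) = φ(2)`. The degree of a monomial representation
therefore determines `k`. -/
theorem totient_injective (H : HolomorphGenerators p n r a b ζ) :
    Function.Injective fun k => Nat.totient (p ^ k) := by
  refine StrictMono.injective (strictMono_nat_of_lt_succ fun k => ?_)
  have h2 := H.prime.two_le
  have h3 := H.odd
  rcases k with _ | k
  · rw [zero_add, pow_one, pow_zero, Nat.totient_prime H.prime, Nat.totient_one]
    omega
  · rw [Nat.totient_prime_pow_succ H.prime, Nat.totient_prime_pow_succ H.prime]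
    have := Nat.pow_lt_pow_right H.prime.one_lt (Nat.lt_succ_self k)
    exact Nat.mul_lt_mul_of_pos_right this (by omega)

/-- The Galois conjugates of a monomial representation are obtained by conjugating the parameter. -/
theorem mem_galoisClass_iff (H : HolomorphGenerators p n r a b ζ) (hk : k ≤ n)
    (hω : ω ^ (Nat.totient (p ^ n) / Nat.totient (p ^ k)) = 1) {d : ℕ} (hd : 0 < d)
    (hωd : IsPrimitiveRoot ω d) (y : IrrepClass ℂ G) :
    y ∈ (H.stdClass hk hω).galoisClass ↔
      ∃ ω' : ℂ, ∃ hω' : ω' ^ (Nat.totient (p ^ n) / Nat.totient (p ^ k)) = 1,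
        IsPrimitiveRoot ω' d ∧ y = H.stdClass hk hω' := by
  have hmem : ω ∈ (H.stdClass hk hω).charField := by
    rw [stdClass_charField]; exact IntermediateField.mem_adjoin_simple_self ℚ ω
  have hωF : IsPrimitiveRoot (⟨ω, hmem⟩ : (H.stdClass hk hω).charField) d :=
    IsPrimitiveRoot.coe_submonoidClass_iff.mp hωd
  constructor
  · rintro ⟨σ, hσ⟩
    obtain ⟨k', hk', ω', hω', rfl⟩ := H.exists_eq_stdClass y
    have h1 := hσ 1
    have e1 : (⟨(H.stdClass hk hω).character 1, (H.stdClass hk hω).character_mem_charField 1⟩ :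
        (H.stdClass hk hω).charField) = (Nat.totient (p ^ k) : ℕ) := by
      ext
      simp [stdClass_character]
    rw [e1, map_natCast, stdClass_character, Representation.char_one, Module.finrank_fin_fun] at h1
    -- At the identity a conjugate character takes the same value, so the degrees agree.
    have hkk : k' = k := H.totient_injective (by exact_mod_cast h1)
    subst hkk
    refine ⟨ω', hω', ?_, rfl⟩
    have h2 := hσ (b ^ Nat.totient (p ^ k'))
    have e2 : (⟨(H.stdClass hk hω).character (b ^ Nat.totient (p ^ k')),
        (H.stdClass hk hω).character_mem_charField _⟩ : (H.stdClass hk hω).charField) =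
        (Nat.totient (p ^ k') : ℕ) * ⟨ω, hmem⟩ := by
      ext
      simp [stdClass_character, stdRep_character_b_pow]
    rw [e2, map_mul, map_natCast, stdClass_character, stdRep_character_b_pow] at h2
    have h3 : ω' = (σ ⟨ω, hmem⟩ : ℂ) :=
      mul_left_cancel₀ (Nat.cast_ne_zero.mpr (H.totient_pos k').ne') h2
    rw [h3]
    exact IsPrimitiveRoot.coe_submonoidClass_iff.mpr (hωF.map_of_injective σ.injective)
  · rintro ⟨ω', hω', hωd', rfl⟩
    obtain ⟨σ, hσ⟩ := exists_algEquiv_adjoin_root hd hωd hωd' (H.stdClass_charField hk hω) hmem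
    refine ⟨σ, fun g => ?_⟩
    obtain ⟨q, j, h⟩ := H.exists_rat_stdRep_character hk g
    have e : (⟨(H.stdClass hk hω).character g, (H.stdClass hk hω).character_mem_charField g⟩ :
        (H.stdClass hk hω).charField) = ⟨ω, hmem⟩ ^ j * algebraMap ℚ _ q := by
      ext
      simp [stdClass_character, h ω hω]
    rw [e, map_mul, map_pow, AlgEquiv.commutes, stdClass_character, h ω' hω', ← hσ]
    rfl

end

end HolomorphGenerators

/-! ### Cyclotomic relations over `ℚ` and the dimension bound -/

theorem aeval_cyclotomic_rat_eq_zero_iff {D : ℕ} (hD : 0 < D) {R : Type*} [CommRing R] [IsDomain R]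
    [Algebra ℚ R] {μ : R} :
    Polynomial.aeval μ (Polynomial.cyclotomic D ℚ) = 0 ↔ IsPrimitiveRoot μ D := by
  have : CharZero R := algebraRat.charZero R
  have : NeZero (D : R) := ⟨Nat.cast_ne_zero.mpr hD.ne'⟩
  rw [Polynomial.aeval_def, Polynomial.eval₂_eq_eval_map, Polynomial.map_cyclotomic]
  exact Polynomial.isRoot_cyclotomic_iff

theorem pow_eq_one_of_aeval_cyclotomic {D : ℕ} {A : Type*} [Ring A] [Algebra ℚ A] {x : A}
    (h : Polynomial.aeval x (Polynomial.cyclotomic D ℚ) = 0) : x ^ D = 1 := by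
  obtain ⟨q, hq⟩ := Polynomial.cyclotomic.dvd_X_pow_sub_one D ℚ
  have := congrArg (Polynomial.aeval x) hq
  rw [map_mul, h, zero_mul, map_sub, map_pow, Polynomial.aeval_X, map_one] at this
  exact sub_eq_zero.mp this

theorem complexification_tmul {G : Type v} [Group G] {V : Type u} [AddCommGroup V] [Module ℚ V]
    (ρ : Representation ℚ G V) (g : G) (c : ℂ) (v : V) :
    complexification ρ g (c ⊗ₜ v) = c ⊗ₜ ρ g v := rfl

theorem LinearMap.aeval_apply_of_comm {R V W : Type*} [CommRing R] [AddCommGroup V] [Module R V]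
    [AddCommGroup W] [Module R W] (F : V →ₗ[R] W) {f : Module.End R V} {g : Module.End R W}
    (h : ∀ v, F (f v) = g (F v)) (P : Polynomial R) (v : V) :
    F (Polynomial.aeval f P v) = Polynomial.aeval g P (F v) := by
  have hpow : ∀ i v, F ((f ^ i) v) = (g ^ i) (F v) := fun i => by
    induction i with
    | zero => simp
    | succ i ih => intro v; rw [pow_succ', Module.End.mul_apply, h, ih, pow_succ']; rfl
  simp [Polynomial.aeval_eq_sum_range, LinearMap.sum_apply, hpow]

section

variable {V : Type*} [AddCommGroup V] [Module ℚ V]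

theorem aeval_baseChange (f : Module.End ℚ V) (P : Polynomial ℚ) :
    Polynomial.aeval (f.baseChange ℂ : Module.End ℂ (ℂ ⊗[ℚ] V)) (P.map (algebraMap ℚ ℂ)) =
      (Polynomial.aeval f P).baseChange ℂ := by
  rw [Polynomial.aeval_map_algebraMap]
  exact Polynomial.aeval_algHom_apply (Module.End.baseChangeHom ℚ ℂ V) f P

theorem aeval_eq_zero_of_baseChange_eigenvector {f : Module.End ℚ V} {P : Polynomial ℚ}
    (hP : Polynomial.aeval f P = 0) {v : ℂ ⊗[ℚ] V} (hv : v ≠ 0) {μ : ℂ}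
    (h : f.baseChange ℂ v = μ • v) : Polynomial.aeval μ P = 0 := by
  have h1 := aeval_baseChange f P
  rw [hP, LinearMap.baseChange_zero] at h1
  have h2 : Module.End.HasEigenvector (f.baseChange ℂ : Module.End ℂ (ℂ ⊗[ℚ] V)) μ v :=
    ⟨Module.End.mem_eigenspace_iff.mpr h, hv⟩
  have h3 := Module.End.aeval_apply_of_hasEigenvector (p := P.map (algebraMap ℚ ℂ)) h2
  rw [h1, LinearMap.zero_apply, eq_comm, smul_eq_zero, or_iff_left hv] at h3
  rwa [Polynomial.eval_map_algebraMap] at h3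

/-- An irreducible `P` that kills `f` is associated to the minimal polynomial, hence divides the
characteristic polynomial, which base change preserves. So every complex root of `P` is an
eigenvalue. -/
theorem exists_baseChange_eigenvector [FiniteDimensional ℚ V] [Nontrivial V] {f : Module.End ℚ V}
    {P : Polynomial ℚ} (hirr : Irreducible P) (hP : Polynomial.aeval f P = 0) {μ : ℂ}
    (hμ : Polynomial.aeval μ P = 0) : ∃ v ≠ 0, f.baseChange ℂ v = μ • v := by
  have h1 : P ∣ minpoly ℚ f := by
    obtain ⟨q, hq⟩ := minpoly.dvd ℚ f hP
    rcases hirr.isUnit_or_isUnit hq with h | h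
    · exact absurd h (minpoly.not_isUnit ℚ f)
    · obtain ⟨u, rfl⟩ := h
      exact ⟨(u⁻¹ : Units _), by rw [hq, mul_assoc, Units.mul_inv, mul_one]⟩
  obtain ⟨q, hq⟩ := h1.trans (LinearMap.minpoly_dvd_charpoly f)
  have h2 : Module.End.HasEigenvalue (f.baseChange ℂ : Module.End ℂ (ℂ ⊗[ℚ] V)) μ := by
    rw [Module.End.hasEigenvalue_iff_isRoot_charpoly, LinearMap.charpoly_baseChange,
      Polynomial.IsRoot, Polynomial.eval_map_algebraMap, hq, map_mul, hμ, zero_mul]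
  obtain ⟨v, hv⟩ := h2.exists_hasEigenvector
  exact ⟨v, hv.2, hv.apply_eq_smul⟩

end

namespace HolomorphGenerators

variable {p n r : ℕ} {G : Type v} [Group G] {a b : G} {ζ : ℂ}

section

variable {k d : ℕ} {ω : ℂ}

/-- The complexification of a rational representation on which `a` and `b ^ φ (p ^ k)` are killed
by cyclotomic polynomials contains all the corresponding joint eigenvectors. -/
theorem exists_complexification_eigenvector (H : HolomorphGenerators p n r a b ζ) (hk : k ≤ n)
    (hd : 0 < d) {W : Type*} [AddCommGroup W] [Module ℚ W] [FiniteDimensional ℚ W] [Nontrivial W]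
    (ρ : Representation ℚ G W)
    (ha : Polynomial.aeval (ρ a) (Polynomial.cyclotomic (p ^ k) ℚ) = 0)
    (hb : Polynomial.aeval (ρ (b ^ Nat.totient (p ^ k))) (Polynomial.cyclotomic d ℚ) = 0)
    (hω : IsPrimitiveRoot ω d) :
    ∃ v ≠ 0, complexification ρ a v = (ζ ^ p ^ (n - k)) • v ∧
      complexification ρ (b ^ Nat.totient (p ^ k)) v = ω • v := by
  -- The relation `Φ_{p ^ k}(ρ a) = 0` gives `ρ a ^ p ^ k = 1`, and `r ^ φ(p ^ k) ≡ 1` modulo `p ^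
  -- k`; hence the two operators commute.
  have hcomm : ρ (a * b ^ Nat.totient (p ^ k)) = ρ (b ^ Nat.totient (p ^ k) * a) := by
    have h1 : ρ a ^ r ^ Nat.totient (p ^ k) = ρ a := by
      have h2 : r ^ Nat.totient (p ^ k) % p ^ k = 1 % p ^ k :=
        (H.pow_modEq_one_iff hk _).mpr dvd_rfl
      rw [pow_eq_pow_mod _ (pow_eq_one_of_aeval_cyclotomic ha), h2,
        ← pow_eq_pow_mod _ (pow_eq_one_of_aeval_cyclotomic ha), pow_one]
    rw [mul_pow_eq_of_rel H.rel, map_mul, map_pow ρ a, h1, ← map_mul]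
  have hcomm' : ∀ v, complexification ρ (b ^ Nat.totient (p ^ k)) (complexification ρ a v) =
      complexification ρ a (complexification ρ (b ^ Nat.totient (p ^ k)) v) := fun v => by
    rw [← Module.End.mul_apply, ← map_mul, ← Module.End.mul_apply, ← map_mul]
    simp only [complexification, MonoidHom.comp_apply, hcomm]
  obtain ⟨w, hw, hbw⟩ := exists_baseChange_eigenvector (Polynomial.cyclotomic.irreducible_rat hd) hb
    ((aeval_cyclotomic_rat_eq_zero_iff hd).mpr hω)
  -- The `ω`-eigenspace of `b ^ φ(p ^ k)` is a subrepresentation, so a joint eigenvector can be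
  -- sought inside it; `Φ_{p ^ k}` then forces its level to be `k`.
  obtain ⟨S, hS⟩ := exists_subrepresentation_of_closure (ρ := complexification ρ) H.closure_eq_top
    H.isOfFinOrder
    (Module.End.eigenspace (complexification ρ (b ^ Nat.totient (p ^ k))) ω) (by
      rintro g (rfl | rfl) v hv <;> rw [Module.End.mem_eigenspace_iff] at hv ⊢
      · rw [hcomm', hv, map_smul]
      · rw [← map_smul, ← hv, ← Module.End.mul_apply, ← map_mul, ← Module.End.mul_apply, ← map_mul,
          ← pow_succ, ← pow_succ'])
  have hwS : w ∈ S.toSubmodule := by rw [hS]; exact Module.End.mem_eigenspace_iff.mpr hbw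
  have : Nontrivial S.toSubmodule := ⟨⟨w, hwS⟩, 0, fun h => hw (congrArg Subtype.val h)⟩
  obtain ⟨k', hk', ω', -, u, hu, hau, -⟩ := H.exists_joint_eigenvector S.toRepresentation
  have hu' : (u : ℂ ⊗[ℚ] W) ≠ 0 := fun h => hu (Subtype.ext h)
  have hau' : complexification ρ a u = (ζ ^ p ^ (n - k')) • (u : ℂ ⊗[ℚ] W) :=
    congrArg Subtype.val hau
  have h1 := (aeval_cyclotomic_rat_eq_zero_iff (H.pow_pos k)).mp
    (aeval_eq_zero_of_baseChange_eigenvector ha hu' hau')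
  have hkk : k' = k := Nat.pow_right_injective H.prime.two_le ((H.isPrimitiveRoot hk').unique h1)
  subst hkk
  refine ⟨u, hu', hau', ?_⟩
  exact Module.End.mem_eigenspace_iff.mp (hS.le u.2)

theorem pow_eq_one_of_isPrimitiveRoot {e : ℕ} {ω ω' : ℂ} (hω : ω ^ e = 1)
    (h : IsPrimitiveRoot ω d) (h' : IsPrimitiveRoot ω' d) : ω' ^ e = 1 := by
  obtain ⟨q, rfl⟩ := h.dvd_of_pow_eq_one _ hω
  rw [pow_mul, h'.pow_eq_one, one_pow]

theorem card_galoisClass (H : HolomorphGenerators p n r a b ζ) (hk : k ≤ n)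
    (hω : ω ^ (Nat.totient (p ^ n) / Nat.totient (p ^ k)) = 1) (hd : 0 < d)
    (hωd : IsPrimitiveRoot ω d) : Nat.card (H.stdClass hk hω).galoisClass = Nat.totient d := by
  have hval : ∀ x : primitiveRoots d ℂ, IsPrimitiveRoot (x : ℂ) d := fun x =>
    (mem_primitiveRoots hd).mp x.2
  let F : primitiveRoots d ℂ → (H.stdClass hk hω).galoisClass := fun x =>
    ⟨H.stdClass hk (pow_eq_one_of_isPrimitiveRoot hω hωd (hval x)),
      (H.mem_galoisClass_iff hk hω hd hωd _).mpr ⟨x, _, hval x, rfl⟩⟩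
  have hF : Function.Bijective F := by
    constructor
    · intro x y hxy
      exact Subtype.ext ((H.stdClass_inj hk _ hk _).mp (congrArg Subtype.val hxy)).2
    · rintro ⟨y, hy⟩
      obtain ⟨ω', hω', hωd', rfl⟩ := (H.mem_galoisClass_iff hk hω hd hωd _).mp hy
      exact ⟨⟨ω', (mem_primitiveRoots hd).mpr hωd'⟩, rfl⟩
  rw [← Nat.card_congr (Equiv.ofBijective F hF), Nat.card_eq_fintype_card, Fintype.card_coe,
    hωd.card_primitiveRoots]

theorem finite_galoisClass (H : HolomorphGenerators p n r a b ζ) (hk : k ≤ n)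
    (hω : ω ^ (Nat.totient (p ^ n) / Nat.totient (p ^ k)) = 1) (hd : 0 < d)
    (hωd : IsPrimitiveRoot ω d) : Finite (H.stdClass hk hω).galoisClass :=
  Nat.finite_of_card_ne_zero (by
    rw [H.card_galoisClass hk hω hd hωd]; exact (Nat.totient_pos.mpr hd).ne')

theorem finrank_galoisClass_directSum (H : HolomorphGenerators p n r a b ζ) (hk : k ≤ n)
    (hω : ω ^ (Nat.totient (p ^ n) / Nat.totient (p ^ k)) = 1) (hd : 0 < d)
    (hωd : IsPrimitiveRoot ω d) :
    Module.finrank ℂ (DirectSum (H.stdClass hk hω).galoisClass fun y => y.1.out.V) =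
      Nat.totient d * Nat.totient (p ^ k) := by
  have := H.finite_galoisClass hk hω hd hωd
  have := Fintype.ofFinite (H.stdClass hk hω).galoisClass
  rw [Module.finrank_directSum, Finset.sum_const_nat (m := Nat.totient (p ^ k)), Finset.card_univ,
    ← Nat.card_eq_fintype_card, H.card_galoisClass hk hω hd hωd]
  rintro ⟨y, hy⟩ -
  obtain ⟨ω', hω', -, rfl⟩ := (H.mem_galoisClass_iff hk hω hd hωd _).mp hy
  obtain ⟨e⟩ := H.nonempty_equiv_stdRep hk hω'
  rw [e.toLinearEquiv.finrank_eq]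
  simp

theorem out_b_pow (H : HolomorphGenerators p n r a b ζ) (hk : k ≤ n)
    (hω : ω ^ (Nat.totient (p ^ n) / Nat.totient (p ^ k)) = 1) {x : IrrepClass ℂ G}
    (hx : x = H.stdClass hk hω) (v : x.out.V) :
    x.out.ρ (b ^ Nat.totient (p ^ k)) v = ω • v := by
  subst hx
  obtain ⟨e⟩ := H.nonempty_equiv_stdRep hk hω
  apply e.toLinearEquiv.injective
  have := Representation.IntertwiningMap.isIntertwining _ _ e.toIntertwiningMap (b ^ Nat.totient (p ^ k)) v
  rw [stdRep_b_pow, ← map_smul] at this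
  exact this

/-- The sum of the Galois conjugates of a monomial representation embeds into the complexification
of each rational representation with the same cyclotomic relations. -/
theorem exists_injective_directSum (H : HolomorphGenerators p n r a b ζ) (hk : k ≤ n)
    (hω : ω ^ (Nat.totient (p ^ n) / Nat.totient (p ^ k)) = 1) (hd : 0 < d)
    (hωd : IsPrimitiveRoot ω d) {W : Type*} [AddCommGroup W] [Module ℚ W] [FiniteDimensional ℚ W]
    [Nontrivial W] (ρ : Representation ℚ G W)
    (ha : Polynomial.aeval (ρ a) (Polynomial.cyclotomic (p ^ k) ℚ) = 0)
    (hb : Polynomial.aeval (ρ (b ^ Nat.totient (p ^ k))) (Polynomial.cyclotomic d ℚ) = 0) :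
    ∃ F : Representation.IntertwiningMap
      (Representation.directSum fun y : (H.stdClass hk hω).galoisClass => y.1.out.ρ)
      (complexification ρ), Function.Injective F := by
  classical
  have hy : ∀ y : (H.stdClass hk hω).galoisClass, ∃ ω' : ℂ,
      ∃ hω' : ω' ^ (Nat.totient (p ^ n) / Nat.totient (p ^ k)) = 1,
        IsPrimitiveRoot ω' d ∧ y.1 = H.stdClass hk hω' := fun y =>
    (H.mem_galoisClass_iff hk hω hd hωd _).mp y.2
  choose w hw hwd hwy using hy
  have hf : ∀ y : (H.stdClass hk hω).galoisClass,
      ∃ f : Representation.IntertwiningMap y.1.out.ρ (complexification ρ), f ≠ 0 := fun y => by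
    rw [hwy y]
    exact (H.exists_stdClass_ne_zero_iff hk (hw y) _).mpr
      (H.exists_complexification_eigenvector hk hd ρ ha hb (hwd y))
  choose f hf using hf
  have hinj : ∀ y, Function.Injective (f y) := fun y =>
    have := y.1.out.irreducible
    (Representation.IsIrreducible.injective_or_eq_zero (f y)).resolve_right (hf y)
  let c := complexification ρ (b ^ Nat.totient (p ^ k))
  have hc : ∀ y v, f y v ∈ Module.End.eigenspace c (w y) := by
    intro y v
    rw [Module.End.mem_eigenspace_iff, ← (f y).isIntertwining, ← map_smul]
    congr 1
    exact H.out_b_pow hk (hw y) (hwy y) v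
  have hwinj : Function.Injective w := fun y y' h => by
    apply Subtype.ext
    rw [hwy y, hwy y']
    exact (H.stdClass_inj hk _ hk _).mpr ⟨rfl, h⟩
  -- Different conjugates have different parameters, so their images lie in distinct eigenspaces of
  -- `b ^ φ(p ^ k)` and are independent.
  have hind : iSupIndep fun y => Module.End.eigenspace c (w y) :=
    (Module.End.eigenspaces_iSupIndep c).comp hwinj
  let T : (DirectSum (H.stdClass hk hω).galoisClass fun y => y.1.out.V) →ₗ[ℂ] ℂ ⊗[ℚ] W :=
    DirectSum.toModule ℂ _ _ fun y => (f y).toLinearMap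
  have hT : ∀ g, T ∘ₗ Representation.directSum
      (fun y : (H.stdClass hk hω).galoisClass => y.1.out.ρ) g = complexification ρ g ∘ₗ T := by
    refine fun g => DirectSum.linearMap_ext ℂ fun y => LinearMap.ext fun v => ?_
    simp only [T, LinearMap.comp_apply, Representation.directSum_apply, DirectSum.lmap_lof,
      DirectSum.toModule_lof]
    exact Representation.IntertwiningMap.isIntertwining _ _ (f y) g v
  refine ⟨T.intertwiningMap_of_isIntertwiningMap _ _ fun g => LinearMap.congr_fun (hT g), ?_⟩
  let f' : ∀ y : (H.stdClass hk hω).galoisClass,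
      y.1.out.V →ₗ[ℂ] Module.End.eigenspace c (w y) := fun y =>
    (f y).toLinearMap.codRestrict _ (hc y)
  have h1 : Function.Injective (DirectSum.lmap f') :=
    (DirectSum.lmap_injective _).mpr fun y u v huv => hinj y (congrArg Subtype.val huv)
  have h2 : T =
      DirectSum.coeLinearMap (fun y => Module.End.eigenspace c (w y)) ∘ₗ DirectSum.lmap f' := by
    refine DirectSum.linearMap_ext ℂ fun y => LinearMap.ext fun v => ?_
    simp only [T, LinearMap.comp_apply, DirectSum.lmap_lof, DirectSum.toModule_lof,
      DirectSum.coeLinearMap_lof]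
    rfl
  change Function.Injective T
  rw [h2]
  exact hind.dfinsupp_lsum_injective.comp h1

/-- A rational representation of minimal dimension with the given cyclotomic relations is
irreducible, and its complexification is the sum of the Galois conjugates of a monomial
representation. -/
theorem isIrreducible_and_directSum_of_finrank (H : HolomorphGenerators p n r a b ζ) (hk : k ≤ n)
    (hd : 0 < d) (hde : d ∣ Nat.totient (p ^ n) / Nat.totient (p ^ k)) {W : Type*}
    [AddCommGroup W] [Module ℚ W] [FiniteDimensional ℚ W]
    (ρ : Representation ℚ G W)
    (ha : Polynomial.aeval (ρ a) (Polynomial.cyclotomic (p ^ k) ℚ) = 0)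
    (hb : Polynomial.aeval (ρ (b ^ Nat.totient (p ^ k))) (Polynomial.cyclotomic d ℚ) = 0)
    (hW : Module.finrank ℚ W = Nat.totient d * Nat.totient (p ^ k)) :
    ρ.IsIrreducible ∧ ∀ (ω : ℂ) (hω : ω ^ (Nat.totient (p ^ n) / Nat.totient (p ^ k)) = 1),
      IsPrimitiveRoot ω d → Nonempty ((complexification ρ).Equiv
        (Representation.directSum fun y : (H.stdClass hk hω).galoisClass => y.1.out.ρ)) := by
  have : Nontrivial W := Module.nontrivial_of_finrank_pos (R := ℚ)
    (by rw [hW]; exact Nat.mul_pos (Nat.totient_pos.mpr hd) (H.totient_pos k))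
  constructor
  · refine Representation.isIrreducible_of_forall fun S ⟨w, hwS, hw⟩ => ?_
    have : Nontrivial S.toSubmodule := ⟨⟨w, hwS⟩, 0, fun h => hw (congrArg Subtype.val h)⟩
    have hrestr : ∀ (g : G) (P : Polynomial ℚ), Polynomial.aeval (ρ g) P = 0 →
        Polynomial.aeval (S.toRepresentation g) P = 0 := by
      intro g P hP
      refine LinearMap.ext fun v => Subtype.ext ?_
      have := LinearMap.aeval_apply_of_comm S.toSubmodule.subtype (f := S.toRepresentation g)
        (g := ρ g) (fun _ => rfl) P v
      rw [hP, LinearMap.zero_apply] at this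
      exact this
    let ω := Complex.exp (2 * Real.pi * Complex.I / d)
    have hω : IsPrimitiveRoot ω d := Complex.isPrimitiveRoot_exp d hd.ne'
    obtain ⟨F, hF⟩ := H.exists_injective_directSum hk (((hω.pow_eq_one_iff_dvd _).mpr hde)) hd hω S.toRepresentation
      (hrestr _ _ ha) (hrestr _ _ hb)
    -- The complexification of `S` already contains the whole orbit sum, whose dimension is that of
    -- `W`.
    have h1 := LinearMap.finrank_le_finrank_of_injective (f := F.toLinearMap) hF
    rw [H.finrank_galoisClass_directSum hk _ hd hω, Module.finrank_baseChange, ← hW] at h1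
    exact Submodule.eq_top_of_finrank_eq (le_antisymm (Submodule.finrank_le _) h1)
  · intro ω hω hωd
    obtain ⟨F, hF⟩ := H.exists_injective_directSum hk hω hd hωd ρ ha hb
    have := H.finite_galoisClass hk hω hd hωd
    have := Fintype.ofFinite (H.stdClass hk hω).galoisClass
    have h1 := LinearMap.injective_iff_surjective_of_finrank_eq_finrank (f := F.toLinearMap) (by
      rw [H.finrank_galoisClass_directSum hk _ hd hωd, Module.finrank_baseChange, hW])
    exact ⟨(F.ofBijective ⟨hF, h1.mp hF⟩).symm⟩

end

end HolomorphGenerators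

/-! ### Realization over `ℚ` in the minimal dimension -/

theorem aeval_diagonalEnd {R K : Type*} [CommRing R] [AddCommGroup K] [Module R K] {f r : ℕ}
    {α : Module.End R K} {P : Polynomial R} (h : ∀ j, Polynomial.aeval (α ^ r ^ j) P = 0) :
    Polynomial.aeval (diagonalEnd f r α) P = 0 := by
  refine LinearMap.ext fun v => funext fun j => ?_
  have := LinearMap.aeval_apply_of_comm (LinearMap.proj j) (f := diagonalEnd f r α)
    (g := α ^ r ^ (j : ℕ)) (fun _ => rfl) P v
  rw [h, LinearMap.zero_apply] at this
  exact this

theorem aeval_compLeft {R K : Type*} [CommRing R] [AddCommGroup K] [Module R K] {f : ℕ}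
    {T : Module.End R K} {P : Polynomial R} (h : Polynomial.aeval T P = 0) :
    Polynomial.aeval (T.compLeft (Fin f) : Module.End R (Fin f → K)) P = 0 := by
  refine LinearMap.ext fun v => funext fun j => ?_
  have := LinearMap.aeval_apply_of_comm (LinearMap.proj j)
    (f := (T.compLeft (Fin f) : Module.End R (Fin f → K))) (g := T) (fun _ => rfl) P v
  rw [h, LinearMap.zero_apply] at this
  exact this

theorem aeval_lmul {K : Type*} [Field K] [Algebra ℚ K] {D : ℕ} (hD : 0 < D) {z : K}
    (hz : IsPrimitiveRoot z D) :
    Polynomial.aeval (Algebra.lmul ℚ K z) (Polynomial.cyclotomic D ℚ) = 0 := by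
  rw [Polynomial.aeval_algHom_apply, (aeval_cyclotomic_rat_eq_zero_iff hD).mpr hz, map_zero]

/-- The iterates of a semilinear endomorphism `z τ` with `τ z = z ^ u`. -/
theorem lmul_mul_algEquiv_pow {K : Type*} [Field K] [Algebra ℚ K] {z : K} (τ : K ≃ₐ[ℚ] K) {u : ℕ}
    (hτ : τ z = z ^ u) (j : ℕ) (x : K) :
    ((Algebra.lmul ℚ K z * τ.toLinearMap : Module.End ℚ K) ^ j) x =
      z ^ (∑ l ∈ Finset.range j, u ^ l) * (τ ^ j) x := by
  induction j with
  | zero => simp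
  | succ j ih =>
    rw [pow_succ', Module.End.mul_apply, ih, geom_sum_succ, pow_succ' τ, AlgEquiv.mul_apply]
    change z * τ (_ * _) = _
    rw [map_mul, map_pow, hτ, ← pow_mul, ← mul_assoc, ← pow_succ']

namespace HolomorphGenerators

variable {p n r : ℕ} {G : Type v} [Group G] {a b : G} {ζ : ℂ}

section

variable {k d : ℕ}

/-- A class of irreducible rational representations that realizes the sum of the Galois conjugates
of the monomial representations of degree `φ (p ^ k)` whose parameter has order `d`. -/
structure IsRationalClass (H : HolomorphGenerators p n r a b ζ) (hk : k ≤ n) (d : ℕ)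
    (c : IrrepClass ℚ G) : Prop where
  aeval_a : Polynomial.aeval (c.out.ρ a) (Polynomial.cyclotomic (p ^ k) ℚ) = 0
  aeval_b : Polynomial.aeval (c.out.ρ (b ^ Nat.totient (p ^ k))) (Polynomial.cyclotomic d ℚ) = 0
  orbitSum : ∀ (ω : ℂ) (hω : ω ^ (Nat.totient (p ^ n) / Nat.totient (p ^ k)) = 1),
    IsPrimitiveRoot ω d → c.IsGaloisOrbitSum (H.stdClass hk hω)

theorem exists_isRationalClass_of_representation (H : HolomorphGenerators p n r a b ζ)
    (hk : k ≤ n) (hd : 0 < d) (hde : d ∣ Nat.totient (p ^ n) / Nat.totient (p ^ k)) {W : Type}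
    [AddCommGroup W] [Module ℚ W] [FiniteDimensional ℚ W] (ρ : Representation ℚ G W)
    (ha : Polynomial.aeval (ρ a) (Polynomial.cyclotomic (p ^ k) ℚ) = 0)
    (hb : Polynomial.aeval (ρ (b ^ Nat.totient (p ^ k))) (Polynomial.cyclotomic d ℚ) = 0)
    (hW : Module.finrank ℚ W = Nat.totient d * Nat.totient (p ^ k)) :
    ∃ c, H.IsRationalClass hk d c := by
  let X : Irrep ℚ G := ⟨W, ρ, (H.isIrreducible_and_directSum_of_finrank hk hd hde ρ ha hb hW).1⟩
  let c : IrrepClass ℚ G := Quotient.mk _ X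
  obtain ⟨e⟩ : Nonempty (c.out.ρ.Equiv ρ) := Quotient.mk_out X
  have htransfer : ∀ (g : G) (P : Polynomial ℚ), Polynomial.aeval (ρ g) P = 0 →
      Polynomial.aeval (c.out.ρ g) P = 0 := by
    refine fun g P hP => LinearMap.ext fun v => e.toLinearEquiv.injective ?_
    have := LinearMap.aeval_apply_of_comm e.toLinearEquiv.toLinearMap (f := c.out.ρ g) (g := ρ g)
      (fun v => Representation.IntertwiningMap.isIntertwining _ _ e.toIntertwiningMap g v) P v
    rw [hP, LinearMap.zero_apply] at this
    rw [LinearMap.zero_apply, map_zero]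
    exact this
  exact ⟨c, htransfer _ _ ha, htransfer _ _ hb,
    (H.isIrreducible_and_directSum_of_finrank hk hd hde c.out.ρ (htransfer _ _ ha)
      (htransfer _ _ hb) (e.toLinearEquiv.finrank_eq.trans hW)).2⟩

/-- This reduces the realization to a choice of `α` and `T` on one block `K`: after `f * t = φ(p ^
k)` shifts, `b` acts on every block as `T ^ t`. The condition `hdim` is minimality of the dimension.
-/
theorem exists_isRationalClass_of_monomial (H : HolomorphGenerators p n r a b ζ) (hk : k ≤ n)
    (hd : 0 < d) (hde : d ∣ Nat.totient (p ^ n) / Nat.totient (p ^ k)) {K : Type} [Field K]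
    [Algebra ℚ K] [FiniteDimensional ℚ K] {f t : ℕ} (hft : f * t = Nat.totient (p ^ k))
    {α T : Module.End ℚ K} (hαT : α * T = T * α ^ r ^ f)
    (hα : ∀ j, Polynomial.aeval (α ^ r ^ j) (Polynomial.cyclotomic (p ^ k) ℚ) = 0)
    (hT : Polynomial.aeval (T ^ t) (Polynomial.cyclotomic d ℚ) = 0)
    (hdim : f * Module.finrank ℚ K = Nat.totient d * Nat.totient (p ^ k)) :
    ∃ c, H.IsRationalClass hk d c := by
  obtain ⟨ρ, hρa, hρb⟩ := H.pres.exists_monomial_representation (R := ℚ) (K := K) (f := f)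
    (s := t * (Nat.totient (p ^ n) / Nat.totient (p ^ k))) (α := α) (T := T) (H.pow_pos n)
    (H.totient_pos n) (by rw [← mul_assoc, hft, H.totient_mul_div hk])
    (by
      have h := pow_eq_one_of_aeval_cyclotomic (hα 0)
      rw [pow_zero, pow_one] at h
      rw [← Nat.sub_add_cancel hk, pow_add, mul_comm, pow_mul, h, one_pow])
    (by
      obtain ⟨q, hq⟩ := hde
      rw [hq, pow_mul, pow_mul, pow_eq_one_of_aeval_cyclotomic hT, one_pow]) hαT
  refine H.exists_isRationalClass_of_representation hk hd hde ρ ?_ ?_ ?_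
  · rw [hρa]; exact aeval_diagonalEnd hα
  · rw [map_pow, hρb, ← hft, pow_mul, cyclicShiftEnd_pow_self, compLeft_pow]
    exact aeval_compLeft hT
  · rw [Module.finrank_pi_fintype, Finset.sum_const, Finset.card_univ, Fintype.card_fin,
      smul_eq_mul, hdim]

/-- Here `ℚ(ζ_d)` contains the `p ^ k`-th roots of unity, so both `α` and `T` can be
multiplications; this is the monomial representation over `ℚ(ζ_d)` with scalars restricted. -/
theorem exists_isRationalClass_of_dvd (H : HolomorphGenerators p n r a b ζ) (hk : k ≤ n)
    (hd : 0 < d) (hde : d ∣ Nat.totient (p ^ n) / Nat.totient (p ^ k)) (hkd : p ^ k ∣ d) :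
    ∃ c, H.IsRationalClass hk d c := by
  have : NeZero d := ⟨hd.ne'⟩
  obtain ⟨K, _, _, _⟩ := exists_isCyclotomicExtension_rat d
  have : FiniteDimensional ℚ K := IsCyclotomicExtension.finiteDimensional {d} ℚ K
  obtain ⟨z, hz⟩ : ∃ z : K, IsPrimitiveRoot z d := ⟨_, IsCyclotomicExtension.zeta_spec d ℚ K⟩
  obtain ⟨q, rfl⟩ := hkd
  have hξ : IsPrimitiveRoot (z ^ q) (p ^ k) := hz.pow hd (mul_comm _ _)
  refine H.exists_isRationalClass_of_monomial hk hd hde (K := K) (f := Nat.totient (p ^ k)) (t := 1)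
    (mul_one _) (α := Algebra.lmul ℚ K (z ^ q)) (T := Algebra.lmul ℚ K z) ?_ (fun j => ?_) ?_ ?_
  · rw [← map_pow, ← map_mul, ← map_mul,
      hξ.pow_eq_pow_of_modEq ((H.pow_modEq_one_iff hk _).mpr dvd_rfl), pow_one, mul_comm]
  · rw [← map_pow]
    exact aeval_lmul (H.pow_pos k) (hξ.pow_of_coprime _ (Nat.Coprime.pow_left j (H.coprime k)))
  · rw [pow_one]
    exact aeval_lmul hd hz
  · rw [IsCyclotomicExtension.finrank K (Polynomial.cyclotomic.irreducible_rat hd), mul_comm]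

theorem totient_eq_pow_mul (H : HolomorphGenerators p n r a b ζ) {i k : ℕ} (hi : 1 ≤ i)
    (hik : i ≤ k) : Nat.totient (p ^ k) = Nat.totient (p ^ i) * p ^ (k - i) := by
  rw [Nat.totient_prime_pow H.prime (by omega), Nat.totient_prime_pow H.prime (by omega),
    mul_right_comm, ← pow_add, show i - 1 + (k - i) = k - 1 by omega]

theorem totient_div_eq (H : HolomorphGenerators p n r a b ζ) (hk1 : 1 ≤ k) (hk : k ≤ n) :
    Nat.totient (p ^ n) / Nat.totient (p ^ k) = p ^ (n - k) := by
  rw [H.totient_eq_pow_mul hk1 hk, Nat.mul_div_cancel_left _ (H.totient_pos k)]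

theorem not_modEq_one (H : HolomorphGenerators p n r a b ζ) {e : ℕ}
    (he : ¬ Nat.totient p ∣ e) : ¬ r ^ e ≡ 1 [MOD p] := by
  have := H.pow_modEq_one_iff (k := 1) H.pos e
  rw [pow_one] at this
  rwa [this]

/-- If `u = r ^ (φ (p ^ k) - φ (p ^ i))`, then `1 + u + u ^ 2 + …`, with `φ (p ^ k) / φ (p ^ i)`
terms, has the `p`-adic valuation `k - i` if `1 ≤ i`, and at least `k` if `i = 0`. -/
theorem isPrimitiveRoot_pow_geom_sum (H : HolomorphGenerators p n r a b ζ) {i t : ℕ} (hik : i < k)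
    (hk : k ≤ n) (ht : Nat.totient (p ^ i) * t = Nat.totient (p ^ k)) {u : ℕ}
    (hu : u = r ^ (Nat.totient (p ^ k) - Nat.totient (p ^ i))) {K : Type*} [Field K] {z : K}
    (hz : IsPrimitiveRoot z (p ^ k)) :
    IsPrimitiveRoot (z ^ ∑ l ∈ Finset.range t, u ^ l) (p ^ i) := by
  have : Fact p.Prime := ⟨H.prime⟩
  have hpodd : Odd p := H.prime.odd_of_ne_two H.odd
  have htp : ¬ Nat.totient p ∣ 1 := by
    have h2 := H.prime.two_le
    have h3 := H.odd
    rw [Nat.totient_prime H.prime, Nat.dvd_one]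
    omega
  have hr0 : r ≠ 0 := by
    rintro rfl
    have := H.coprime 1
    rw [pow_one, Nat.coprime_zero_left] at this
    exact H.prime.one_lt.ne' this
  have hr1 : r ≠ 1 := by
    rintro rfl
    exact H.not_modEq_one htp rfl
  have hlt : Nat.totient (p ^ i) < Nat.totient (p ^ k) :=
    lt_of_le_of_ne (Nat.le_of_dvd (H.totient_pos k) ⟨t, ht.symm⟩)
      fun h => hik.ne (H.totient_injective h)
  have hu1 : 1 < u := hu ▸ Nat.one_lt_pow (by omega) (by omega)
  have hut : u ^ t ≡ 1 [MOD p ^ k] := by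
    rw [hu, ← pow_mul, H.pow_modEq_one_iff hk, Nat.sub_mul, ht]
    exact Nat.dvd_sub (dvd_mul_right _ _) dvd_rfl
  obtain ⟨w, rfl⟩ : ∃ w, u = w + 1 := ⟨u - 1, by omega⟩
  have hS := geom_sum_mul_add w t
  set S := ∑ l ∈ Finset.range t, (w + 1) ^ l with hSdef
  have hSw : (w + 1) ^ t - 1 = S * w := by omega
  have hdvd : p ^ k ∣ S * w := by
    rw [← hSw]
    exact (Nat.modEq_iff_dvd' (Nat.one_le_pow _ _ (by omega))).mp hut.symm
  have ht0 : t ≠ 0 := by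
    rintro rfl
    have := H.totient_pos k
    omega
  rcases Nat.eq_zero_or_pos i with rfl | hi
  -- If `p ∣ u - 1`, then `p - 1` would divide both `φ(p ^ k) - 1` and `φ(p ^ k)`, which fails for
  -- odd `p`. So `u - 1` is a unit modulo `p ^ k` and the geometric sum itself vanishes there.
  · have hpw : ¬ p ∣ w := by
      intro h
      have h1 : r ^ (Nat.totient (p ^ k) - Nat.totient (p ^ 0)) ≡ 1 [MOD p] := by
        rw [← hu]
        simpa using (Nat.modEq_zero_iff_dvd.mpr h).add_right 1
      refine htp ?_
      have h2 := not_not.mp (mt H.not_modEq_one (not_not.mpr h1))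
      have h3 : Nat.totient p ∣ Nat.totient (p ^ k) :=
        Nat.totient_dvd_of_dvd (dvd_pow_self p (by omega))
      rw [pow_zero, Nat.totient_one] at h2
      have h4 := Nat.dvd_sub h3 h2
      rwa [Nat.sub_sub_self (H.totient_pos k)] at h4
    have hcop : (p ^ k).Coprime w :=
      Nat.Coprime.pow_left k ((Nat.Prime.coprime_iff_not_dvd H.prime).mpr hpw)
    rw [(hz.pow_eq_one_iff_dvd S).mpr (hcop.dvd_of_dvd_mul_right hdvd), pow_zero]
    exact IsPrimitiveRoot.one
  · have hpw : p ∣ w := by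
      have h1 : w + 1 ≡ 1 [MOD p ^ i] := by
        rw [hu, H.pow_modEq_one_iff (by omega)]
        exact Nat.dvd_sub ⟨t, ht.symm⟩ dvd_rfl
      have h2 := (Nat.modEq_iff_dvd' (by omega)).mp h1.symm
      rw [Nat.add_sub_cancel] at h2
      exact (dvd_pow_self p (by omega)).trans h2
    have hpu : ¬ p ∣ w + 1 := fun h =>
      H.prime.one_lt.ne' (Nat.dvd_one.mp ((Nat.dvd_add_right hpw).mp h))
    have htpow : t = p ^ (k - i) := by
      rw [H.totient_eq_pow_mul hi hik.le] at ht
      exact Nat.eq_of_mul_eq_mul_left (H.totient_pos i) ht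
    have hw0 : w ≠ 0 := by omega
    have hS0 : S ≠ 0 := by
      rintro h
      rw [h, zero_mul] at hS
      have := Nat.one_lt_pow ht0 hu1
      omega
    -- Lifting the exponent: `u ^ t - 1` has the valuation of `u - 1` plus that of `t = p ^ (k -
    -- i)`, so the geometric sum has valuation `k - i`.
    have hval := padicValNat.pow_sub_pow hpodd hu1 (by simpa using hpw) hpu ht0
    rw [one_pow, hSw, Nat.add_sub_cancel, padicValNat.mul hS0 hw0, add_comm, htpow,
      padicValNat.prime_pow] at hval
    have hvS : padicValNat p S = k - i := Nat.add_left_cancel hval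
    obtain ⟨q, hq⟩ := hvS ▸ pow_padicValNat_dvd (p := p) (n := S)
    have hpq : ¬ p ∣ q := by
      rintro ⟨q', rfl⟩
      exact pow_succ_padicValNat_not_dvd (p := p) hS0 ⟨q', by rw [hvS, pow_succ, mul_assoc, ← hq]⟩
    rw [hq, pow_mul]
    refine (hz.pow (H.pow_pos k) ?_).pow_of_coprime q
      (Nat.Coprime.pow_right i ((Nat.Prime.coprime_iff_not_dvd H.prime).mpr hpq).symm)
    rw [← pow_add, Nat.sub_add_cancel hik.le]

/-- The field `ℚ(ζ_d)` lacks the eigenvalues of `a`, and the full monomial representation over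
`ℚ(ζ_{p ^ k})` is too large. Folding the shift onto `φ(p ^ i)` blocks, with a Galois automorphism
absorbed into the corner, gives the right dimension. -/
theorem exists_isRationalClass_of_lt (H : HolomorphGenerators p n r a b ζ) (hk : k ≤ n) {i : ℕ}
    (hik : i < k) (hde : p ^ i ∣ Nat.totient (p ^ n) / Nat.totient (p ^ k)) :
    ∃ c, H.IsRationalClass hk (p ^ i) c := by
  have : NeZero (p ^ k) := ⟨(H.pow_pos k).ne'⟩
  obtain ⟨K, _, _, _⟩ := exists_isCyclotomicExtension_rat (p ^ k)
  have : FiniteDimensional ℚ K := IsCyclotomicExtension.finiteDimensional {p ^ k} ℚ K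
  obtain ⟨z, hz⟩ : ∃ z : K, IsPrimitiveRoot z (p ^ k) :=
    ⟨_, IsCyclotomicExtension.zeta_spec (p ^ k) ℚ K⟩
  obtain ⟨t, ht⟩ := Nat.totient_dvd_of_dvd (pow_dvd_pow p hik.le)
  have hle : Nat.totient (p ^ i) ≤ Nat.totient (p ^ k) :=
    Nat.le_of_dvd (H.totient_pos k) ⟨t, ht⟩
  -- An inverse of `r ^ φ(p ^ i)` modulo `p ^ k`, written as a power of `r`; it makes the corner
  -- satisfy `α T = T α ^ r ^ f` with `f = φ(p ^ i)`.
  let u := r ^ (Nat.totient (p ^ k) - Nat.totient (p ^ i))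
  have huf : u * r ^ Nat.totient (p ^ i) ≡ 1 [MOD p ^ k] := by
    rw [← pow_add, Nat.sub_add_cancel hle]
    exact (H.pow_modEq_one_iff hk _).mpr dvd_rfl
  have hut : u ^ t ≡ 1 [MOD p ^ k] := by
    rw [← pow_mul, H.pow_modEq_one_iff hk, Nat.sub_mul, ← ht]
    exact Nat.dvd_sub (dvd_mul_right _ _) dvd_rfl
  have hzu : IsPrimitiveRoot (z ^ u) (p ^ k) :=
    hz.pow_of_coprime _ (Nat.Coprime.pow_left _ (H.coprime k))
  obtain ⟨τ, hτ⟩ := exists_algEquiv_of_isPrimitiveRoot hz hzu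
  have hτpow : ∀ j, (τ ^ j) z = z ^ u ^ j := fun j => by
    induction j with
    | zero => simp
    | succ j ih => rw [pow_succ', AlgEquiv.mul_apply, ih, map_pow, hτ, ← pow_mul, pow_succ']
  have hτt : τ ^ t = 1 := by
    have h1 : ((τ ^ t : K ≃ₐ[ℚ] K) : K →ₐ[ℚ] K) = ((1 : K ≃ₐ[ℚ] K) : K →ₐ[ℚ] K) := by
      refine (hz.powerBasis ℚ).algHom_ext ?_
      rw [IsPrimitiveRoot.powerBasis_gen ℚ hz]
      change (τ ^ t) z = z
      rw [hτpow, hz.pow_eq_pow_of_modEq hut, pow_one]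
    exact AlgEquiv.ext fun x => DFunLike.congr_fun h1 x
  refine H.exists_isRationalClass_of_monomial hk (H.pow_pos i) hde (K := K) ht.symm
    (α := Algebra.lmul ℚ K z) (T := Algebra.lmul ℚ K z * τ.toLinearMap) ?_ (fun j => ?_) ?_ ?_
  · refine LinearMap.ext fun x => ?_
    rw [← map_pow]
    change z * (z * τ x) = z * τ (z ^ _ * x)
    rw [map_mul, map_pow, hτ, ← pow_mul, hz.pow_eq_pow_of_modEq huf, pow_one]
  · rw [← map_pow]
    exact aeval_lmul (H.pow_pos k) (hz.pow_of_coprime _ (Nat.Coprime.pow_left j (H.coprime k)))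
  -- Since `τ ^ t = 1`, the power `T ^ t` is linear over `K`: it is multiplication by `z` to a
  -- geometric sum.
  · have hTt : (Algebra.lmul ℚ K z * τ.toLinearMap : Module.End ℚ K) ^ t =
        Algebra.lmul ℚ K (z ^ ∑ l ∈ Finset.range t, u ^ l) := by
      refine LinearMap.ext fun x => ?_
      rw [lmul_mul_algEquiv_pow τ hτ, hτt]
      rfl
    rw [hTt]
    exact aeval_lmul (H.pow_pos i) (H.isPrimitiveRoot_pow_geom_sum hik hk ht.symm rfl hz)
  · rw [IsCyclotomicExtension.finrank K (Polynomial.cyclotomic.irreducible_rat (H.pow_pos k))]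

theorem exists_isRationalClass (H : HolomorphGenerators p n r a b ζ) (hk : k ≤ n)
    (hde : d ∣ Nat.totient (p ^ n) / Nat.totient (p ^ k)) :
    ∃ c, H.IsRationalClass hk d c := by
  have hpos : 0 < Nat.totient (p ^ n) / Nat.totient (p ^ k) :=
    Nat.pos_of_mul_pos_left (H.totient_mul_div hk ▸ H.totient_pos n)
  by_cases hkd : p ^ k ∣ d
  · exact H.exists_isRationalClass_of_dvd hk (Nat.pos_of_dvd_of_pos hde hpos) hde hkd
  · have hk1 : 1 ≤ k := by
      by_contra h
      rw [show k = 0 by omega, pow_zero] at hkd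
      exact hkd (one_dvd d)
    obtain ⟨i, -, rfl⟩ := (Nat.dvd_prime_pow H.prime).mp (H.totient_div_eq hk1 hk ▸ hde)
    refine H.exists_isRationalClass_of_lt hk ?_ hde
    by_contra h
    exact hkd (pow_dvd_pow p (by omega))

end

end HolomorphGenerators

/-! ### Descent to `ℚ` and classification of the rational irreducible representations -/

/-- A nonzero intertwining map between complexifications yields one over the rationals. -/
theorem exists_intertwiningMap_ne_zero_of_complexification {G : Type v} [Group G] {V W : Type u}
    [AddCommGroup V] [Module ℚ V] [AddCommGroup W] [Module ℚ W] {ρ : Representation ℚ G V}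
    {σ : Representation ℚ G W}
    (Ψ : Representation.IntertwiningMap (complexification ρ) (complexification σ)) (hΨ : Ψ ≠ 0) :
    ∃ f : Representation.IntertwiningMap ρ σ, f ≠ 0 := by
  obtain ⟨v, hv⟩ : ∃ v, Ψ (1 ⊗ₜ v) ≠ 0 := by
    by_contra! h
    refine hΨ (Representation.IntertwiningMap.ext (LinearMap.ext fun t => ?_))
    change Ψ t = 0
    induction t using TensorProduct.induction_on with
    | zero => exact map_zero Ψ
    | tmul c v =>
      rw [show c ⊗ₜ[ℚ] v = c • ((1 : ℂ) ⊗ₜ[ℚ] v) by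
        rw [TensorProduct.smul_tmul', smul_eq_mul, mul_one], map_smul, h, smul_zero]
    | add x y hx hy => rw [map_add, hx, hy, add_zero]
  -- A `ℚ`-basis of `ℂ` splits `ℂ ⊗ W` into copies of `W` on which `G` acts coordinatewise; a
  -- nonzero coordinate of `Ψ (1 ⊗ v)` gives the rational map.
  let B := Module.Basis.ofVectorSpace ℚ ℂ
  let E := TensorProduct.equivFinsuppOfBasisLeft (N := W) B
  have hE : ∀ g t i, E (complexification σ g t) i = σ g (E t i) := by
    intro g t i
    induction t using TensorProduct.induction_on with
    | zero => simp
    | tmul c w =>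
      rw [complexification_tmul]
      simp [E]
    | add x y hx hy => simp [hx, hy]
  obtain ⟨i, hi⟩ : ∃ i, E (Ψ (1 ⊗ₜ v)) i ≠ 0 := by
    by_contra! h
    exact hv (E.map_eq_zero_iff.mp (Finsupp.ext h))
  let F : V →ₗ[ℚ] W := Finsupp.lapply i ∘ₗ E.toLinearMap ∘ₗ Ψ.toLinearMap.restrictScalars ℚ ∘ₗ
    TensorProduct.mk ℚ ℂ V 1
  have hF : ∀ v, F v = E (Ψ (1 ⊗ₜ v)) i := fun _ => rfl
  refine ⟨F.intertwiningMap_of_isIntertwiningMap ρ σ fun g v => ?_, fun h => hi ?_⟩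
  · rw [hF, hF, ← complexification_tmul, Ψ.isIntertwining, hE]
  · exact DFunLike.congr_fun h v

theorem IrrepClass.character_eq_out {k : Type u} [Field k] {G : Type v} [Group G]
    (c : IrrepClass k G) : c.character = c.out.ρ.character := by
  conv_lhs => rw [← Quotient.out_eq c]
  rfl

theorem IrrepClass.eq_of_intertwiningMap_ne_zero {k : Type u} [Field k] {G : Type v} [Group G]
    {c c' : IrrepClass k G} (f : Representation.IntertwiningMap c.out.ρ c'.out.ρ) (hf : f ≠ 0) :
    c = c' := by
  have h1 := c.out.irreducible
  have h2 := c'.out.irreducible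
  have hbij := (Representation.IsIrreducible.bijective_or_eq_zero f).resolve_right hf
  rw [← Quotient.out_eq c, ← Quotient.out_eq c']
  exact Quotient.sound ⟨f.ofBijective hbij⟩

namespace HolomorphGenerators

variable {p n r : ℕ} {G : Type v} [Group G] {a b : G} {ζ : ℂ}

theorem div_pos (H : HolomorphGenerators p n r a b ζ) {k : ℕ} (hk : k ≤ n) :
    0 < Nat.totient (p ^ n) / Nat.totient (p ^ k) :=
  Nat.pos_of_mul_pos_left (H.totient_mul_div hk ▸ H.totient_pos n)

/-- The commutator of `b⁻¹` and `a` is `a ^ (r - 1)`. For odd `p` the exponent `r - 1` is prime to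
`p`, so `a` is a power of it. -/
theorem a_mem_commutator (H : HolomorphGenerators p n r a b ζ) : a ∈ commutator G := by
  have hr0 : r ≠ 0 := by
    rintro rfl
    have := H.coprime 1
    rw [pow_one, Nat.coprime_zero_left] at this
    exact H.prime.one_lt.ne' this
  obtain ⟨w, rfl⟩ : ∃ w, r = w + 1 := ⟨r - 1, by omega⟩
  have hpw : ¬ p ∣ w := by
    intro h
    refine H.not_modEq_one (e := 1) ?_ ?_
    · have h2 := H.prime.two_le
      have h3 := H.odd
      rw [Nat.totient_prime H.prime, Nat.dvd_one]
      omega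
    · simpa using (Nat.modEq_zero_iff_dvd.mpr h).add_right 1
  have h1 : a ^ w = b⁻¹ * a * b * a⁻¹ := by
    rw [mul_assoc b⁻¹, H.rel, inv_mul_cancel_left, pow_succ, mul_inv_cancel_right]
  have h2 : a ^ w ∈ commutator G := by
    rw [h1, commutator_def]
    simpa [commutatorElement_def] using
      Subgroup.commutator_mem_commutator (Subgroup.mem_top b⁻¹) (Subgroup.mem_top a)
  have h3 : w.Coprime (orderOf a) :=
    Nat.Coprime.coprime_dvd_right (orderOf_dvd_of_pow_eq_one H.pow_a)
      (Nat.Coprime.pow_right n ((Nat.Prime.coprime_iff_not_dvd H.prime).mpr hpw).symm)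
  obtain ⟨m, hm⟩ := exists_pow_eq_self_of_coprime h3
  rw [← hm]
  exact Subgroup.pow_mem _ h2 m

section

variable {k k' d d' : ℕ} {ω ω' : ℂ} {c c' : IrrepClass ℚ G}

/-- Eigenvalues in the complexification are roots of the two cyclotomic polynomials, and conversely
every pair of such roots has a joint eigenvector. -/
theorem IsRationalClass.stdClass_mem_iff {H : HolomorphGenerators p n r a b ζ} {hk : k ≤ n}
    (hc : H.IsRationalClass hk d c) (hd : 0 < d) (hk' : k' ≤ n)
    (hω : ω ^ (Nat.totient (p ^ n) / Nat.totient (p ^ k')) = 1) :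
    H.stdClass hk' hω ∈ c.complexConstituents ↔ k' = k ∧ IsPrimitiveRoot ω d := by
  have := c.out.nontrivial
  refine (H.exists_stdClass_ne_zero_iff hk' hω _).trans ⟨?_, ?_⟩
  · rintro ⟨v, hv, hva, hvb⟩
    have h1 := (aeval_cyclotomic_rat_eq_zero_iff (H.pow_pos k)).mp
      (aeval_eq_zero_of_baseChange_eigenvector hc.aeval_a hv hva)
    have hkk : k' = k := Nat.pow_right_injective H.prime.two_le ((H.isPrimitiveRoot hk').unique h1)
    subst hkk
    exact ⟨rfl, (aeval_cyclotomic_rat_eq_zero_iff hd).mp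
      (aeval_eq_zero_of_baseChange_eigenvector hc.aeval_b hv hvb)⟩
  · rintro ⟨rfl, hωd⟩
    exact H.exists_complexification_eigenvector hk hd _ hc.aeval_a hc.aeval_b hωd

theorem IsRationalClass.complexConstituents_eq {H : HolomorphGenerators p n r a b ζ} {hk : k ≤ n}
    (hc : H.IsRationalClass hk d c) (hd : 0 < d)
    (hω : ω ^ (Nat.totient (p ^ n) / Nat.totient (p ^ k)) = 1) (hωd : IsPrimitiveRoot ω d) :
    c.complexConstituents = (H.stdClass hk hω).galoisClass := by
  ext y
  rw [H.mem_galoisClass_iff hk hω hd hωd]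
  obtain ⟨k', hk', ω', hω', rfl⟩ := H.exists_eq_stdClass y
  rw [hc.stdClass_mem_iff hd]
  constructor
  · rintro ⟨rfl, h⟩
    exact ⟨ω', hω', h, rfl⟩
  · rintro ⟨ω'', hω'', h, heq⟩
    obtain ⟨rfl, rfl⟩ := (H.stdClass_inj hk' hω' hk hω'').mp heq
    exact ⟨rfl, h⟩

/-- A rational irreducible representation that shares a constituent with a realization of the sum
of the Galois conjugates of a monomial representation is isomorphic to it. -/
theorem IsRationalClass.eq_of_mem {H : HolomorphGenerators p n r a b ζ} {hk : k ≤ n}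
    (hc : H.IsRationalClass hk d c) (hd : 0 < d)
    (hω : ω ^ (Nat.totient (p ^ n) / Nat.totient (p ^ k)) = 1) (hωd : IsPrimitiveRoot ω d)
    (hmem : H.stdClass hk hω ∈ c'.complexConstituents) : c = c' := by
  classical
  obtain ⟨f, hf⟩ := hmem
  obtain ⟨e⟩ := hc.orbitSum ω hω hωd
  let y : (H.stdClass hk hω).galoisClass :=
    ⟨H.stdClass hk hω, (H.mem_galoisClass_iff hk hω hd hωd _).mpr ⟨ω, hω, hωd, rfl⟩⟩
  let π : Representation.IntertwiningMap
      (Representation.directSum fun y : (H.stdClass hk hω).galoisClass => y.1.out.ρ) y.1.out.ρ :=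
    (DirectSum.component ℂ _ _ y).intertwiningMap_of_isIntertwiningMap _ _ fun _ _ => rfl
  obtain ⟨v, hv⟩ : ∃ v, f v ≠ 0 := by
    by_contra! h
    exact hf (Representation.IntertwiningMap.ext (LinearMap.ext h))
  -- Projecting the complexification of `c` onto the shared constituent and mapping that into the
  -- complexification of `c'` is nonzero, so it descends.
  obtain ⟨φ, hφ⟩ := exists_intertwiningMap_ne_zero_of_complexification
    ((f.comp π).comp e.toIntertwiningMap) (fun h => hv (by
      have h1 := DFunLike.congr_fun h (e.symm (DirectSum.lof ℂ _ _ y v))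
      have h2 : e.toIntertwiningMap (e.symm (DirectSum.lof ℂ _ _ y v)) =
        DirectSum.lof ℂ _ _ y v := e.apply_symm_apply _
      have h3 : π (DirectSum.lof ℂ _ _ y v) = v := DirectSum.component.lof_self ℂ _ _
      rw [Representation.IntertwiningMap.comp_apply, h2,
        Representation.IntertwiningMap.comp_apply, h3] at h1
      exact h1))
  exact IrrepClass.eq_of_intertwiningMap_ne_zero φ hφ

/-- Some monomial representation occurs in the complexification of `c`. The rational realization of
its Galois orbit shares this constituent with `c`, hence is `c`. -/
theorem exists_eq_isRationalClass (H : HolomorphGenerators p n r a b ζ) (c : IrrepClass ℚ G) :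
    ∃ k, ∃ hk : k ≤ n, ∃ d, d ∣ Nat.totient (p ^ n) / Nat.totient (p ^ k) ∧ 0 < d ∧
      H.IsRationalClass hk d c := by
  have := c.out.nontrivial
  obtain ⟨k, hk, ω, hω, hv⟩ := H.exists_joint_eigenvector (complexification c.out.ρ)
  have hde := orderOf_dvd_of_pow_eq_one hω
  have hd := Nat.pos_of_dvd_of_pos hde (H.div_pos hk)
  obtain ⟨c', hc'⟩ := H.exists_isRationalClass hk hde
  have := hc'.eq_of_mem hd hω (IsPrimitiveRoot.orderOf ω)
    ((H.exists_stdClass_ne_zero_iff hk hω _).mpr hv)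
  exact ⟨k, hk, _, hde, hd, this ▸ hc'⟩

theorem eq_of_mem_complexConstituents (H : HolomorphGenerators p n r a b ζ)
    {x : IrrepClass ℂ G} (hx : x ∈ c.complexConstituents) (hx' : x ∈ c'.complexConstituents) :
    c = c' := by
  obtain ⟨k, hk, d, -, hd, hc⟩ := H.exists_eq_isRationalClass c
  obtain ⟨k', hk', ω, hω, rfl⟩ := H.exists_eq_stdClass x
  obtain ⟨rfl, hωd⟩ := (hc.stdClass_mem_iff hd hk' hω).mp hx
  exact hc.eq_of_mem hd hω hωd hx'

theorem exists_parameter (H : HolomorphGenerators p n r a b ζ) (hk : k ≤ n)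
    (hde : d ∣ Nat.totient (p ^ n) / Nat.totient (p ^ k)) :
    ∃ ω : ℂ, IsPrimitiveRoot ω d ∧ ω ^ (Nat.totient (p ^ n) / Nat.totient (p ^ k)) = 1 := by
  have hω := Complex.isPrimitiveRoot_exp d (Nat.pos_of_dvd_of_pos hde (H.div_pos hk)).ne'
  exact ⟨_, hω, (hω.pow_eq_one_iff_dvd _).mpr hde⟩

theorem IsRationalClass.unique {H : HolomorphGenerators p n r a b ζ} {hk : k ≤ n} {hk' : k' ≤ n}
    (hde : d ∣ Nat.totient (p ^ n) / Nat.totient (p ^ k)) (hd' : 0 < d')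
    (hc : H.IsRationalClass hk d c) (hc' : H.IsRationalClass hk' d' c) : k = k' ∧ d = d' := by
  obtain ⟨ω, hωd, hω⟩ := H.exists_parameter hk hde
  have h := (hc.stdClass_mem_iff (Nat.pos_of_dvd_of_pos hde (H.div_pos hk)) hk hω).mpr ⟨rfl, hωd⟩
  obtain ⟨rfl, h'⟩ := (hc'.stdClass_mem_iff hd' hk hω).mp h
  exact ⟨rfl, hωd.unique h'⟩

theorem IsRationalClass.eq {H : HolomorphGenerators p n r a b ζ} {hk : k ≤ n}
    (hde : d ∣ Nat.totient (p ^ n) / Nat.totient (p ^ k)) (hc : H.IsRationalClass hk d c)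
    (hc' : H.IsRationalClass hk d c') : c = c' := by
  obtain ⟨ω, hωd, hω⟩ := H.exists_parameter hk hde
  have hd := Nat.pos_of_dvd_of_pos hde (H.div_pos hk)
  exact hc.eq_of_mem hd hω hωd ((hc'.stdClass_mem_iff hd hk hω).mpr ⟨rfl, hωd⟩)

theorem IsRationalClass.commutator_subset_kernel_iff {H : HolomorphGenerators p n r a b ζ}
    {hk : k ≤ n} (hc : H.IsRationalClass hk d c) :
    (commutator G : Set G) ⊆ c.kernel ↔ k = 0 := by
  have := c.out.nontrivial
  constructor
  · intro h
    by_contra hk0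
    have h1 : ∀ j : ℕ, c.out.ρ.character (a ^ j) = Module.finrank ℚ c.out.V := fun j => by
      have h2 : c.character (a ^ j) = c.character 1 :=
        h (Subgroup.pow_mem _ H.a_mem_commutator j)
      rw [c.character_eq_out, Representation.char_one] at h2
      exact h2
    -- For `k ≥ 1`, `Φ_{p ^ k}` divides `1 + X + ⋯ + X ^ (p ^ k - 1)`. Were the character constant
    -- on the powers of `a`, the trace of this sum would be `p ^ k` times the dimension, not zero.
    have h2 : ∑ j ∈ Finset.range (p ^ k), c.out.ρ a ^ j = 0 := by
      obtain ⟨q, hq⟩ := Polynomial.cyclotomic_dvd_geom_sum_of_dvd ℚ (dvd_refl (p ^ k))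
        (Nat.one_lt_pow hk0 H.prime.one_lt).ne'
      have := congrArg (Polynomial.aeval (c.out.ρ a)) hq
      rw [map_mul, hc.aeval_a, zero_mul] at this
      simpa using this
    have h3 := congrArg (LinearMap.trace ℚ c.out.V) h2
    rw [map_sum, map_zero, Finset.sum_congr rfl (g := fun _ => (Module.finrank ℚ c.out.V : ℚ))
      (fun j _ => by rw [← map_pow]; exact h1 j), Finset.sum_const, Finset.card_range,
      nsmul_eq_mul] at h3
    have h4 : 0 < p ^ k * Module.finrank ℚ c.out.V :=
      Nat.mul_pos (H.pow_pos k) Module.finrank_pos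
    exact h4.ne' (by exact_mod_cast h3)
  · rintro rfl
    have ha : c.out.ρ a = 1 := by
      have := pow_eq_one_of_aeval_cyclotomic hc.aeval_a
      rwa [pow_zero, pow_one] at this
    -- With `a` acting trivially the image is generated by that of `b`, hence is commutative.
    have hg : ∀ g, ∃ j, c.out.ρ g = c.out.ρ b ^ j := fun g => by
      obtain ⟨j, i, rfl⟩ := H.exists_eq_pow_mul_pow g
      exact ⟨j, by rw [map_mul, map_pow, map_pow, ha, one_pow, mul_one]⟩
    have hle : commutator G ≤ MonoidHom.ker (c.out.ρ : G →* Module.End ℚ c.out.V) := by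
      rw [commutator_def, Subgroup.commutator_le]
      intro g _ h _
      obtain ⟨i, hi⟩ := hg g
      obtain ⟨j, hj⟩ := hg h
      rw [MonoidHom.mem_ker, commutatorElement_def, mul_assoc, ← mul_inv_rev, map_mul,
        show c.out.ρ (g * h) = c.out.ρ (h * g) by
          rw [map_mul, map_mul, hi, hj, ← pow_add, ← pow_add, add_comm],
        ← map_mul, mul_inv_cancel, map_one]
    intro g hgc
    have h1 : c.out.ρ g = 1 := hle hgc
    change c.character g = c.character 1
    rw [c.character_eq_out, Representation.character, Representation.character, h1, map_one c.out.ρ]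

end

end HolomorphGenerators

/-! ### Matrix forms, the bijections and the count -/

theorem sum_range_sub (n : ℕ) : ∑ k ∈ Finset.range n, (n - k) = n * (n + 1) / 2 := by
  have h1 : ∑ k ∈ Finset.range n, (n - k) = ∑ k ∈ Finset.range n, (k + 1) := by
    rw [← Finset.sum_range_reflect]
    refine Finset.sum_congr rfl fun j hj => ?_
    have := Finset.mem_range.mp hj
    omega
  have h2 := Finset.sum_range_succ' (fun i => i) n
  rw [add_zero] at h2
  rw [h1, ← h2, Finset.sum_range_id, Nat.add_sub_cancel, mul_comm]

theorem diagMatrix_mulVec (m r : ℕ) (z : ℂ) (v : Fin m → ℂ) :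
    (diagMatrix m r z).mulVec v = diagonalEnd m r (z • (1 : Module.End ℂ ℂ)) v := by
  ext j
  rw [diagMatrix, Matrix.mulVec_diagonal, diagonalEnd_apply, smul_pow, one_pow]
  rfl

theorem monomialMatrix_mulVec (m : ℕ) (ω : ℂ) (v : Fin m → ℂ) :
    (monomialMatrix m ω).mulVec v = cyclicShiftEnd m (ω • (1 : Module.End ℂ ℂ)) v := by
  ext i
  have hm : 0 < m := i.pos
  rw [cyclicShiftEnd_apply, Matrix.mulVec, dotProduct]
  split_ifs with hi
  · rw [Finset.sum_eq_single ⟨m - 1, by omega⟩]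
    · simp [monomialMatrix, hi, Nat.sub_add_cancel hm, hm.ne]
    · intro j _ hj
      have hj' : (j : ℕ) + 1 ≠ m := fun h => hj (Fin.ext (by simp only; omega))
      simp [monomialMatrix, hi, hj']
    · simp
  · rw [Finset.sum_eq_single ⟨i - 1, by omega⟩]
    · simp [monomialMatrix, Nat.sub_add_cancel (Nat.pos_of_ne_zero hi)]
    · intro j _ hj
      have hj' : (i : ℕ) ≠ j + 1 := fun h => hj (Fin.ext (by simp only; omega))
      simp [monomialMatrix, hi, hj']
    · simp

namespace HolomorphGenerators

variable {p n r : ℕ} {G : Type v} [Group G] {a b : G} {ζ : ℂ}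

section

variable {k : ℕ} {ω : ℂ}

theorem stdClass_affordedBy (H : HolomorphGenerators p n r a b ζ) (hk : k ≤ n)
    (hω : ω ^ (Nat.totient (p ^ n) / Nat.totient (p ^ k)) = 1) {m : ℕ}
    (hm : m = Nat.totient (p ^ k)) :
    (H.stdClass hk hω).AffordedBy a b (diagMatrix m r (ζ ^ p ^ (n - k))) (monomialMatrix m ω) := by
  subst hm
  let φ := (Matrix.toLinAlgEquiv' : Matrix (Fin (Nat.totient (p ^ k))) (Fin (Nat.totient (p ^ k))) ℂ
    ≃ₐ[ℂ] Module.End ℂ (Fin (Nat.totient (p ^ k)) → ℂ))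
  let τ : G →* Matrix (Fin (Nat.totient (p ^ k))) (Fin (Nat.totient (p ^ k))) ℂ :=
    (φ.symm : _ ≃* _).toMonoidHom.comp (H.stdRep hk hω)
  have hτ : ∀ g, φ (τ g) = H.stdRep hk hω g := fun g => φ.apply_symm_apply _
  refine ⟨τ, φ.injective ?_, φ.injective ?_, ?_⟩
  · rw [hτ, stdRep_a]
    exact LinearMap.ext fun v => (diagMatrix_mulVec _ _ _ v).symm
  · rw [hτ, stdRep_b]
    exact LinearMap.ext fun v => (monomialMatrix_mulVec _ _ v).symm
  · have : matrixRep τ = H.stdRep hk hω := MonoidHom.ext hτ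
    rw [this]
    exact H.nonempty_equiv_stdRep hk hω

end

theorem bijOn_complexConstituents (H : HolomorphGenerators p n r a b ζ) :
    Set.BijOn (IrrepClass.complexConstituents (G := G))
      {c | (commutator G : Set G) ⊆ c.kernel} (IrrepClass.galoisClass '' {x | x.degree = 1}) := by
  have hdeg : ∀ {k : ℕ}, Nat.totient (p ^ k) = 1 ↔ k = 0 := fun {k} => by
    constructor
    · intro h
      exact H.totient_injective (by simpa using h)
    · rintro rfl
      simp
  have hconst : ∀ c : IrrepClass ℚ G, (commutator G : Set G) ⊆ c.kernel → ∃ x : IrrepClass ℂ G,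
      x.degree = 1 ∧ x ∈ c.complexConstituents ∧ c.complexConstituents = x.galoisClass := by
    intro c hcker
    obtain ⟨k, hk, d, hde, hd, hc⟩ := H.exists_eq_isRationalClass c
    obtain ⟨ω, hωd, hω⟩ := H.exists_parameter hk hde
    exact ⟨H.stdClass hk hω,
      (H.stdClass_degree hk hω).trans (hdeg.mpr (hc.commutator_subset_kernel_iff.mp hcker)),
      (hc.stdClass_mem_iff hd hk hω).mpr ⟨rfl, hωd⟩, hc.complexConstituents_eq hd hω hωd⟩
  refine ⟨fun c hc => ?_, fun c hc c' hc' h => ?_, ?_⟩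
  · obtain ⟨x, hx, -, h⟩ := hconst c hc
    exact ⟨x, hx, h.symm⟩
  · obtain ⟨x, -, hx, -⟩ := hconst c hc
    exact H.eq_of_mem_complexConstituents hx (h ▸ hx)
  · rintro _ ⟨x, hx, rfl⟩
    obtain ⟨k, hk, ω, hω, rfl⟩ := H.exists_eq_stdClass x
    have hk0 : k = 0 := hdeg.mp ((H.stdClass_degree hk hω).symm.trans hx)
    have hde := orderOf_dvd_of_pow_eq_one hω
    obtain ⟨c, hc⟩ := H.exists_isRationalClass hk hde
    exact ⟨c, hc.commutator_subset_kernel_iff.mpr hk0, hc.complexConstituents_eq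
      (Nat.pos_of_dvd_of_pos hde (H.div_pos hk)) hω (IsPrimitiveRoot.orderOf ω)⟩

/-- Chooses all realizations at once; pairs outside the admissible range receive an arbitrary class.
-/
theorem exists_rationalClass (H : HolomorphGenerators p n r a b ζ) :
    ∃ R : ℕ → ℕ → IrrepClass ℚ G, ∀ (k d : ℕ) (hk : k ≤ n),
      d ∣ Nat.totient (p ^ n) / Nat.totient (p ^ k) → H.IsRationalClass hk d (R k d) := by
  have h : ∀ k d : ℕ, ∃ c : IrrepClass ℚ G, ∀ hk : k ≤ n,
      d ∣ Nat.totient (p ^ n) / Nat.totient (p ^ k) → H.IsRationalClass hk d c := by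
    intro k d
    by_cases h : ∃ _ : k ≤ n, d ∣ Nat.totient (p ^ n) / Nat.totient (p ^ k)
    · obtain ⟨hk, hde⟩ := h
      obtain ⟨c, hc⟩ := H.exists_isRationalClass hk hde
      exact ⟨c, fun _ _ => hc⟩
    · obtain ⟨c, -⟩ := H.exists_isRationalClass (Nat.zero_le n) (one_dvd _)
      exact ⟨c, fun hk hde => absurd ⟨hk, hde⟩ h⟩
  choose R hR using h
  exact ⟨R, hR⟩

theorem exists_bijOn_degree_one (H : HolomorphGenerators p n r a b ζ) :
    ∃ R : Polynomial ℚ → IrrepClass ℚ G,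
      Set.BijOn R {f | ∃ d, d ∣ Nat.totient (p ^ n) ∧ f = Polynomial.cyclotomic d ℚ}
        {c | (commutator G : Set G) ⊆ c.kernel} ∧
      ∀ d, d ∣ Nat.totient (p ^ n) →
        ∀ ω : ℂ, Polynomial.aeval ω (Polynomial.cyclotomic d ℚ) = 0 →
          ∃ x : IrrepClass ℂ G,
            x.AffordedBy a b (Matrix.diagonal fun _ : Fin 1 => (1 : ℂ))
              (Matrix.diagonal fun _ : Fin 1 => ω) ∧
            x.charField = IntermediateField.adjoin ℚ {ω} ∧
            (R (Polynomial.cyclotomic d ℚ)).IsGaloisOrbitSum x := by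
  obtain ⟨R, hR⟩ := H.exists_rationalClass
  have h0 : Nat.totient (p ^ n) / Nat.totient (p ^ 0) = Nat.totient (p ^ n) := by simp
  have hdiv : ∀ {d}, d ∣ Nat.totient (p ^ n) → d ∣ Nat.totient (p ^ n) / Nat.totient (p ^ 0) :=
    fun h => h0.symm ▸ h
  -- The order `d` is recovered from `Φ_d`, since distinct cyclotomic polynomials have distinct
  -- indices.
  have hinv := Function.leftInverse_invFun (Polynomial.cyclotomic_injective (R := ℚ))
  refine ⟨fun f => R 0 (Function.invFun (fun d => Polynomial.cyclotomic d ℚ) f),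
    ⟨?_, ?_, ?_⟩, ?_⟩
  · rintro _ ⟨d, hd, rfl⟩
    simp only [hinv d]
    exact (hR 0 d (Nat.zero_le n) (hdiv hd)).commutator_subset_kernel_iff.mpr rfl
  · rintro _ ⟨d, hd, rfl⟩ _ ⟨d', hd', rfl⟩ h
    simp only [hinv d, hinv d'] at h
    have := (hR 0 d (Nat.zero_le n) (hdiv hd)).unique (hdiv hd)
      (Nat.pos_of_dvd_of_pos hd' (H.totient_pos n)) (h ▸ hR 0 d' (Nat.zero_le n) (hdiv hd'))
    rw [this.2]
  · intro c hc
    obtain ⟨k, hk, d, hde, hd, hcd⟩ := H.exists_eq_isRationalClass c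
    obtain rfl := hcd.commutator_subset_kernel_iff.mp hc
    refine ⟨_, ⟨d, h0 ▸ hde, rfl⟩, ?_⟩
    simp only [hinv d]
    exact (hR 0 d hk hde).eq hde hcd
  · intro d hd ω hω
    have hdpos := Nat.pos_of_dvd_of_pos hd (H.totient_pos n)
    have hωd := (aeval_cyclotomic_rat_eq_zero_iff hdpos).mp hω
    have hω1 : ω ^ (Nat.totient (p ^ n) / Nat.totient (p ^ 0)) = 1 :=
      (hωd.pow_eq_one_iff_dvd _).mpr (hdiv hd)
    refine ⟨H.stdClass (Nat.zero_le n) hω1, ?_, H.stdClass_charField _ hω1, ?_⟩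
    · have h := H.stdClass_affordedBy (Nat.zero_le n) hω1 (m := 1) (by simp)
      -- At level `k = 0` the root `ξ` is `ζ ^ p ^ n = 1`, and the `1 × 1` monomial matrix is its
      -- corner.
      have e1 : diagMatrix 1 r (ζ ^ p ^ (n - 0)) = Matrix.diagonal fun _ : Fin 1 => (1 : ℂ) := by
        rw [diagMatrix, Nat.sub_zero, H.root.pow_eq_one]
        simp only [one_pow]
      have e2 : monomialMatrix 1 ω = Matrix.diagonal fun _ : Fin 1 => ω := by
        ext i j
        rw [Subsingleton.elim i 0, Subsingleton.elim j 0]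
        simp [monomialMatrix]
      rwa [e1, e2] at h
    · simp only [hinv d]
      exact (hR 0 d (Nat.zero_le n) (hdiv hd)).orbitSum ω hω1 hωd

theorem exists_bijOn_faithful_on_commutator (H : HolomorphGenerators p n r a b ζ) :
    ∃ R : ℕ × Polynomial ℚ → IrrepClass ℚ G,
      Set.BijOn R
        {q | 1 ≤ q.1 ∧ q.1 ≤ n ∧ ∃ i, i ≤ n - q.1 ∧ q.2 = Polynomial.cyclotomic (p ^ i) ℚ}
        {c | ¬ (commutator G : Set G) ⊆ c.kernel} ∧
      ∀ k i, 1 ≤ k → k ≤ n → i ≤ n - k →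
        ∀ ω : ℂ, Polynomial.aeval ω (Polynomial.cyclotomic (p ^ i) ℚ) = 0 →
          ∃ x : IrrepClass ℂ G,
            x.AffordedBy a b (diagMatrix (Nat.totient (p ^ k)) r (ζ ^ p ^ (n - k)))
              (monomialMatrix (Nat.totient (p ^ k)) ω) ∧
            x.charField = IntermediateField.adjoin ℚ {ω} ∧
            (R (k, Polynomial.cyclotomic (p ^ i) ℚ)).IsGaloisOrbitSum x := by
  obtain ⟨R, hR⟩ := H.exists_rationalClass
  have hdiv : ∀ {k i}, 1 ≤ k → k ≤ n → i ≤ n - k →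
      p ^ i ∣ Nat.totient (p ^ n) / Nat.totient (p ^ k) := fun hk1 hk hi => by
    rw [H.totient_div_eq hk1 hk]; exact pow_dvd_pow p hi
  have hinv := Function.leftInverse_invFun (Polynomial.cyclotomic_injective (R := ℚ))
  refine ⟨fun q => R q.1 (Function.invFun (fun d => Polynomial.cyclotomic d ℚ) q.2),
    ⟨?_, ?_, ?_⟩, ?_⟩
  · rintro ⟨k, f⟩ ⟨hk1, hk, i, hi, rfl⟩
    simp only [hinv (p ^ i)]
    exact fun h => absurd ((hR k _ hk (hdiv hk1 hk hi)).commutator_subset_kernel_iff.mp h)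
      (Nat.one_le_iff_ne_zero.mp hk1)
  · rintro ⟨k, f⟩ ⟨hk1, hk, i, hi, rfl⟩ ⟨k', f'⟩ ⟨hk1', hk', i', hi', rfl⟩ h
    simp only [hinv (p ^ i), hinv (p ^ i')] at h
    have := (hR k _ hk (hdiv hk1 hk hi)).unique (hdiv hk1 hk hi) (H.pow_pos i')
      (h ▸ hR k' _ hk' (hdiv hk1' hk' hi'))
    exact Prod.ext this.1 (by simp only; rw [this.2])
  · intro c hc
    obtain ⟨k, hk, d, hde, hd, hcd⟩ := H.exists_eq_isRationalClass c
    have hk1 : 1 ≤ k := Nat.one_le_iff_ne_zero.mpr fun h =>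
      hc (hcd.commutator_subset_kernel_iff.mpr h)
    obtain ⟨i, hi, rfl⟩ := (Nat.dvd_prime_pow H.prime).mp (H.totient_div_eq hk1 hk ▸ hde)
    refine ⟨(k, Polynomial.cyclotomic (p ^ i) ℚ), ⟨hk1, hk, i, hi, rfl⟩, ?_⟩
    simp only [hinv (p ^ i)]
    exact (hR k _ hk hde).eq hde hcd
  · intro k i hk1 hk hi ω hω
    have hωd := (aeval_cyclotomic_rat_eq_zero_iff (H.pow_pos i)).mp hω
    have hω1 := (hωd.pow_eq_one_iff_dvd _).mpr (hdiv hk1 hk hi)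
    refine ⟨H.stdClass hk hω1, H.stdClass_affordedBy hk hω1 rfl, H.stdClass_charField hk hω1, ?_⟩
    simp only [hinv (p ^ i)]
    exact (hR k _ hk (hdiv hk1 hk hi)).orbitSum ω hω1 hωd

/-- At level `0` the order `d` runs over the divisors of `φ(p ^ n)`; at level `k ≥ 1` it runs over
the `n - k + 1` divisors of `p ^ (n - k)`, and these numbers add up to `n (n + 1) / 2`. -/
theorem card_irrepClass_rat (H : HolomorphGenerators p n r a b ζ) :
    Nat.card (IrrepClass ℚ G) =
      (Nat.divisors (Nat.totient (p ^ n))).card + n * (n + 1) / 2 := by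
  obtain ⟨R, hR⟩ := H.exists_rationalClass
  let S := (Finset.range (n + 1)).sigma fun k =>
    Nat.divisors (Nat.totient (p ^ n) / Nat.totient (p ^ k))
  have hS : ∀ q : S, q.1.1 ≤ n ∧ q.1.2 ∣ Nat.totient (p ^ n) / Nat.totient (p ^ q.1.1) := by
    rintro ⟨⟨k, d⟩, hq⟩
    obtain ⟨hk, hd⟩ := Finset.mem_sigma.mp hq
    exact ⟨Nat.lt_succ_iff.mp (Finset.mem_range.mp hk), Nat.dvd_of_mem_divisors hd⟩
  let F : S → IrrepClass ℚ G := fun q => R q.1.1 q.1.2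
  have hF : Function.Bijective F := by
    constructor
    · intro q q' h
      have h1 := hR _ _ (hS q).1 (hS q).2
      have h2 := hR _ _ (hS q').1 (hS q').2
      change R q.1.1 q.1.2 = R q'.1.1 q'.1.2 at h
      rw [← h] at h2
      have := h1.unique (hS q).2 (Nat.pos_of_dvd_of_pos (hS q').2 (H.div_pos (hS q').1)) h2
      exact Subtype.ext (Sigma.ext this.1 (heq_of_eq this.2))
    · intro c
      obtain ⟨k, hk, d, hde, hd, hc⟩ := H.exists_eq_isRationalClass c
      exact ⟨⟨⟨k, d⟩, Finset.mem_sigma.mpr ⟨Finset.mem_range.mpr (Nat.lt_succ_iff.mpr hk),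
        Nat.mem_divisors.mpr ⟨hde, (H.div_pos hk).ne'⟩⟩⟩, (hR k d hk hde).eq hde hc⟩
  rw [← Nat.card_congr (Equiv.ofBijective F hF), Nat.card_eq_fintype_card, Fintype.card_coe,
    Finset.card_sigma, Finset.sum_range_succ', add_comm]
  congr 1
  · simp
  · rw [← sum_range_sub]
    refine Finset.sum_congr rfl fun k hk => ?_
    have := Finset.mem_range.mp hk
    rw [H.totient_div_eq (by omega) (by omega), Nat.divisors_prime_pow H.prime, Finset.card_map,
      Finset.card_range]
    omega

end HolomorphGenerators

end

theorem theorem7p0p2 (p n : ℕ) [Fact p.Prime] (hp : p ≠ 2) (hn : 1 ≤ n)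
    (C : Type*) [Group C] [IsCyclic C] (hC : Nat.card C = p ^ n)
    (r : ℕ) (hr : orderOf (r : ZMod (p ^ n)) = p ^ (n - 1) * (p - 1)) :
    -- the holomorph has the presentation `⟨a, b | a ^ p ^ n = b ^ (p ^ (n-1) (p-1)) = 1, b⁻¹ab = a ^ r⟩`
    (∃ a b : Holomorph C,
      HasMetacyclicPresentation (p ^ n) (p ^ (n - 1) * (p - 1)) r a b) ∧
    -- 1. kernels containing `G'`: Galois classes of complex representations of degree `1`
    Set.BijOn (IrrepClass.complexConstituents (G := Holomorph C))
      {c | (commutator (Holomorph C) : Set (Holomorph C)) ⊆ c.kernel}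
      (IrrepClass.galoisClass '' {x | x.degree = 1}) ∧
    (∀ a b : Holomorph C,
      HasMetacyclicPresentation (p ^ n) (p ^ (n - 1) * (p - 1)) r a b →
      ∀ ζ : ℂ, IsPrimitiveRoot ζ (p ^ n) →
      -- 1. kernels containing `G'`: cyclotomic polynomials
      (∃ R : Polynomial ℚ → IrrepClass ℚ (Holomorph C),
        Set.BijOn R
          {f | ∃ d, d ∣ Nat.totient (p ^ n) ∧ f = Polynomial.cyclotomic d ℚ}
          {c | (commutator (Holomorph C) : Set (Holomorph C)) ⊆ c.kernel} ∧
        ∀ d, d ∣ Nat.totient (p ^ n) →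
          ∀ ω : ℂ, Polynomial.aeval ω (Polynomial.cyclotomic d ℚ) = 0 →
            ∃ x : IrrepClass ℂ (Holomorph C),
              x.AffordedBy a b (Matrix.diagonal fun _ : Fin 1 => (1 : ℂ))
                (Matrix.diagonal fun _ : Fin 1 => ω) ∧
              x.charField = IntermediateField.adjoin ℚ {ω} ∧
              (R (Polynomial.cyclotomic d ℚ)).IsGaloisOrbitSum x) ∧
      -- 2. kernels not containing `G'`
      (∃ R : ℕ × Polynomial ℚ → IrrepClass ℚ (Holomorph C),
        Set.BijOn R
          {q | 1 ≤ q.1 ∧ q.1 ≤ n ∧ ∃ i, i ≤ n - q.1 ∧ q.2 = Polynomial.cyclotomic (p ^ i) ℚ}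
          {c | ¬ (commutator (Holomorph C) : Set (Holomorph C)) ⊆ c.kernel} ∧
        ∀ k i, 1 ≤ k → k ≤ n → i ≤ n - k →
          ∀ ω : ℂ, Polynomial.aeval ω (Polynomial.cyclotomic (p ^ i) ℚ) = 0 →
            ∃ x : IrrepClass ℂ (Holomorph C),
              x.AffordedBy a b
                (diagMatrix (Nat.totient (p ^ k)) r (ζ ^ p ^ (n - k)))
                (monomialMatrix (Nat.totient (p ^ k)) ω) ∧
              x.charField = IntermediateField.adjoin ℚ {ω} ∧
              (R (k, Polynomial.cyclotomic (p ^ i) ℚ)).IsGaloisOrbitSum x)) ∧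
    -- 3. the number of irreducible rational representations
    Nat.card (IrrepClass ℚ (Holomorph C)) =
      (Nat.divisors (Nat.totient (p ^ n))).card + n * (n + 1) / 2 := by
  have hprime : p.Prime := Fact.out
  have htot : Nat.totient (p ^ n) = p ^ (n - 1) * (p - 1) := Nat.totient_prime_pow hprime hn
  rw [← htot] at hr ⊢
  have key : ∀ (a b : Holomorph C) (ζ : ℂ),
      HasMetacyclicPresentation (p ^ n) (Nat.totient (p ^ n)) r a b →
      IsPrimitiveRoot ζ (p ^ n) → HolomorphGenerators p n r a b ζ :=
    fun a b ζ h hζ => ⟨hprime, hp, hn, hr, h, hζ⟩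
  have hpos : 0 < p ^ n := Nat.pow_pos hprime.pos
  -- The bijection with Galois classes and the count do not mention generators, so one choice of
  -- `a`, `b` and of a root of unity proves them.
  obtain ⟨a, b, hab⟩ := exists_hasMetacyclicPresentation_holomorph hpos hr C hC
  have H := key a b _ hab (Complex.isPrimitiveRoot_exp (p ^ n) hpos.ne')
  exact ⟨⟨a, b, hab⟩, H.bijOn_complexConstituents,
    fun a' b' hab' ζ hζ => ⟨(key a' b' ζ hab' hζ).exists_bijOn_degree_one,
      (key a' b' ζ hab' hζ).exists_bijOn_faithful_on_commutator⟩, H.card_irrepClass_rat⟩
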